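/- Let $f:\mathbb R^n\to\mathbb R$ be convex and $L$-smooth ($L>0$: $f$ is differentiable and $\|\nabla f(x)-\nabla f(y)\|_2\le L\|x-y\|_2$ for all $x,y$), let $x^*$ be a minimizer of $f$, $x^0\ne x^*$ and $R_0=\|x^0-x^*\|_2$. Let $\nabla f(x,\xi)$ (jointly measurable in $x$ and $\xi$) be a stochastic gradient with $\mathbb E_\xi[\nabla f(x,\xi)]=\nabla f(x)$ and $\mathbb E_\xi[\|\nabla f(x,\xi)-\nabla f(x)\|_2^2]\le\sigma^2$ for all $x$, where $\sigma\ge0$. Let $\beta\in(0,1)$, $C=\sqrt5$. The method clipped-SSTM with parameters $N$, $a$, $B$, $m_0,m_1,\dots$ sets $A_0=0$, $y^0=z^0=x^0$ and, for $k=0,\dots,N-1$, $$\alpha_{k+1}=\tfrac{k+2}{2aL},\quad A_{k+1}=A_k+\alpha_{k+1},\quad \lambda_{k+1}=\tfrac{B}{\alpha_{k+1}},\quad x^{k+1}=\tfrac{A_ky^k+\alpha_{k+1}z^k}{A_{k+1}},$$ $$g^k=\tfrac1{m_k}\sum_{i=1}^{m_k}\nabla f(x^{k+1},\xi_i^k),\quad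 z^{k+1}=z^k-\alpha_{k+1}\min\{1,\lambda_{k+1}/\|g^k\|_2\}\,g^k,\quad y^{k+1}=\tfrac{A_ky^k+\alpha_{k+1}z^{k+1}}{A_{k+1}},$$ where all samples $\xi_i^k$ are i.i.d. copies of $\xi$; the output is $y^N$ (a clipped zero vector is zero). It makes $\sum_{k=0}^{N-1}m_k$ oracle calls. For $N\ge1$ with $\ln\frac{4N}\beta\ge2$ choose $$B=\frac{CR_0}{8\ln\frac{4N}\beta},\qquad a=\max\Big\{a',\ \frac{\sigma N^{3/2}}{LR_0}\sqrt{\ln\tfrac{4N}\beta}\Big\},$$ $$a'=\max\Big\{1,\ \frac{16\ln\frac{4N}\beta}{C},\ 36\Big(2\ln\tfrac{4N}\beta+\sqrt{4\ln^2\tfrac{4N}\beta+2\ln\tfrac{4N}\beta}\Big)^2\Big\},$$ $$m_k=\left\lceil\max\Big\{1,\ \frac{6000\sigma^2\alpha_{k+1}^2N\ln\frac{4N}\beta}{C^2R_0^2},\ \frac{10368\sigma^2\alpha_{k+1}^2N}{C^2R_0^2}\Big\}\right\rceil .$$ Then there is a numerical constant $K>0$ (independent of $n$, $f$, the distribution of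 $\xi$, $L,\sigma,R_0,\beta,\varepsilon,N$) such that: 1. for every $N\ge 1$ with $\ln\frac{4N}{\beta}\ge2$, $m_k\le K$ for all $k=0,\dots,N$; 2. for every $\varepsilon>0$ there is $N_0\ge1$ with $\ln\frac{4N_0}\beta\ge2$ such that both $N_0$ and the number $\sum_{k=0}^{N_0-1}m_k$ of oracle calls of the run with $N=N_0$ are at most $$K\max\left\{1,\ \max\Big\{\sqrt{\frac{LR_0^2}{\varepsilon}},\frac{\sigma^2R_0^2}{\varepsilon^2}\Big\}\ln\frac{LR_0^2+\sigma R_0}{\varepsilon\beta}\right\},$$ and for every $N\ge N_0$ the method run for $N$ iterations (with the above parameters for this $N$) satisfies $f(y^N)-f(x^*)\le\varepsilon$ with probability at least $1-\beta$. -/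

import Mathlib

open MeasureTheory ProbabilityTheory

universe u v

namespace ClippedSSTM

noncomputable section

/-- `ℝⁿ` with the standard inner product and the Euclidean norm. -/
abbrev E (n : ℕ) : Type := EuclideanSpace ℝ (Fin n)

/-- `f` is `L`-smooth on `ℝⁿ`: differentiable with `L`-Lipschitz gradient. -/
def IsSmooth {n : ℕ} (L : ℝ) (f : E n → ℝ) : Prop :=
  Differentiable ℝ f ∧ ∀ x y : E n, ‖gradient f x - gradient f y‖ ≤ L * ‖x - y‖

/-- `G x ξ`, with `ξ` distributed according to `D`, is an unbiased stochastic gradient of `f`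
with variance uniformly bounded by `σ²`. No other moment or tail condition is imposed. -/
structure IsStochasticGradient {n : ℕ} {Ξ : Type u} [MeasurableSpace Ξ] (D : Measure Ξ)
    (f : E n → ℝ) (G : E n → Ξ → E n) (σ : ℝ) : Prop where
  measurable : Measurable (Function.uncurry G)
  integrable : ∀ x, Integrable (G x) D
  unbiased : ∀ x, ∫ s, G x s ∂D = gradient f x
  sq_integrable : ∀ x, Integrable (fun s => ‖G x s - gradient f x‖ ^ 2) D
  variance_le : ∀ x, ∫ s, ‖G x s - gradient f x‖ ^ 2 ∂D ≤ σ ^ 2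

/-- `clip(g, lam) = min {1, lam / ‖g‖} g` (equal to `0` for `g = 0`). -/
def clip {n : ℕ} (g : E n) (lam : ℝ) : E n := min 1 (lam / ‖g‖) • g

/-- The mini-batched stochastic gradient `(1/m) ∑ G x ξᵢ` over the first `m` samples. -/
def miniBatch {n : ℕ} {Ξ : Type u} (G : E n → Ξ → E n) (x : E n) (m : ℕ) (s : ℕ → Ξ) : E n :=
  (m : ℝ)⁻¹ • ∑ i ∈ Finset.range m, G x (s i)

/-- `α₀ = 0`, `α_{k+1} = (k + 2) / (2 a L)`. -/
def alpha (a L : ℝ) : ℕ → ℝ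
  | 0 => 0
  | k + 1 => ((k : ℝ) + 2) / (2 * a * L)

/-- `A₀ = 0`, `A_{k+1} = A_k + α_{k+1}`. -/
def bigA (a L : ℝ) : ℕ → ℝ
  | 0 => 0
  | k + 1 => bigA a L k + alpha a L (k + 1)

/-- The pair `(yᵏ, zᵏ)` of the method clipped-SSTM with stochastic gradient `G`, starting point
`x0`, batch sizes `m k`, stepsize parameter `a`, smoothness constant `L` and clipping parameter
`B`, where `s k i` is the `i`-th sample drawn in iteration `k`. -/
def iterates {n : ℕ} {Ξ : Type u} (G : E n → Ξ → E n) (a L B : ℝ) (m : ℕ → ℕ) (x0 : E n)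
    (s : ℕ → ℕ → Ξ) : ℕ → E n × E n
  | 0 => (x0, x0)
  | k + 1 =>
    let y := (iterates G a L B m x0 s k).1
    let z := (iterates G a L B m x0 s k).2
    let al := alpha a L (k + 1)
    let lam := B / al
    let x := (bigA a L (k + 1))⁻¹ • (bigA a L k • y + al • z)
    let g := clip (miniBatch G x (m k) (s k)) lam
    let z' := z - al • g
    ((bigA a L (k + 1))⁻¹ • (bigA a L k • y + al • z'), z')

/-- The output `yᴺ` after `N` iterations. -/
def output {n : ℕ} {Ξ : Type u} (G : E n → Ξ → E n) (a L B : ℝ) (m : ℕ → ℕ) (x0 : E n)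
    (s : ℕ → ℕ → Ξ) (N : ℕ) : E n :=
  (iterates G a L B m x0 s N).1

/-- The numerical constant `C = √5`. -/
def constC : ℝ := Real.sqrt 5

/-- `ln (4 N / β)`. -/
def logFactor (N : ℕ) (β : ℝ) : ℝ := Real.log (4 * N / β)

/-- `B = C R₀ / (8 ln (4 N / β))`. -/
def clipParam (R₀ β : ℝ) (N : ℕ) : ℝ := constC * R₀ / (8 * logFactor N β)

/-- `a' = max {1, 16 ℓ / C, 36 (2 ℓ + √(4 ℓ² + 2 ℓ))²}` with `ℓ = ln (4 N / β)`. -/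
def stepParam' (β : ℝ) (N : ℕ) : ℝ :=
  max 1 (max (16 * logFactor N β / constC)
    (36 * (2 * logFactor N β
      + Real.sqrt (4 * logFactor N β ^ 2 + 2 * logFactor N β)) ^ 2))

/-- `a = max {a', σ N^{3/2} √(ln (4 N / β)) / (L R₀)}`. -/
def stepParam (L σ R₀ β : ℝ) (N : ℕ) : ℝ :=
  max (stepParam' β N)
    (σ * (N : ℝ) ^ (3 / 2 : ℝ) / (L * R₀) * Real.sqrt (logFactor N β))

/-- The batch size `m_k` for a run of `N` iterations, rounded up to an integer:
`max {1, 6000 σ² α_{k+1}² N ln (4 N / β) / (C² R₀²), 10368 σ² α_{k+1}² N / (C² R₀²)}`. -/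
def batchSize (L σ R₀ β : ℝ) (N k : ℕ) : ℕ :=
  ⌈max (1 : ℝ)
    (max (6000 * σ ^ 2 * alpha (stepParam L σ R₀ β N) L (k + 1) ^ 2 * N * logFactor N β
        / (constC ^ 2 * R₀ ^ 2))
      (10368 * σ ^ 2 * alpha (stepParam L σ R₀ β N) L (k + 1) ^ 2 * N
        / (constC ^ 2 * R₀ ^ 2)))⌉₊

/-- `max {√(L R₀² / ε), σ² R₀² / ε²} · ln ((L R₀² + σ R₀) / (ε β))`. -/
def complexity (L σ R₀ β ε : ℝ) : ℝ :=
  max (Real.sqrt (L * R₀ ^ 2 / ε)) (σ ^ 2 * R₀ ^ 2 / ε ^ 2)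
    * Real.log ((L * R₀ ^ 2 + σ * R₀) / (ε * β))

end

end ClippedSSTM

/-!
Write `l = ln (4 N / β)`, `ρ = C R₀` and `θᵏ` for the difference between the clipped stochastic
gradient and the gradient at `x^{k+1}`. One step of the method of similar triangles increases the
energy `A_k (f yᵏ - f x*) + ‖zᵏ - x*‖² / 2` by at most the noise
`α ⟪θᵏ, x* - zᵏ⟫ + α² ‖θᵏ‖²`, where `α = α_{k+1}`. So as long as the accumulated noise stays below
`2 ρ² / 5 = 2 R₀²`, the energy stays below `ρ² / 2`, the iterates stay within distance `ρ` of `x*`,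
and, because `a` is at least `36 u²` with `u² = 2 l (2 u + 1)`, the exact gradient is at most half
of the clipping level. Clipping then changes the stochastic gradient only by a term quadratic in its
deviation from the mean, while it keeps the noise of one step of order `ρ² / l`. As the batch sizes
make the variance of order `ρ² / (α² N l)`, the noise of one step, multiplied by `4 l / ρ²`, has
exponential moment at most `exp (l / (100 N))`.

Stop accumulating noise as soon as the budget is exceeded. The batches of different iterations are
independent, so the exponential moments multiply, and by Markov's inequality the stopped noise
reaches the budget with probability at most `exp (-l) ≤ β`. Otherwise it is never stopped and
`f (y^N) - f x* ≤ ρ² / (2 A_N)`. Since `A_N ≥ N² / (4 a L)`, this is at most `ε` as soon as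
`N ≥ 100 max (√(L R₀² / ε), σ² R₀² / ε²) l`; the inequality is implicit in `N`, because `l` depends
on it, and is solved by any `N` above a multiple of the complexity.
-/

namespace ClippedSSTM

section SmoothConvex

variable {F : Type*} [NormedAddCommGroup F] [InnerProductSpace ℝ F] [CompleteSpace F]
  {f : F → ℝ} {L : ℝ} {xs : F}

lemma hasDerivAt_comp_line (hf : Differentiable ℝ f) (x d : F) (t : ℝ) :
    HasDerivAt (fun t : ℝ => f (x + t • d)) (inner ℝ (gradient f (x + t • d)) d) t := by
  have hline : HasDerivAt (fun t : ℝ => x + t • d) d t := by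
    simpa using ((hasDerivAt_id t).smul_const d).const_add x
  exact (hf (x + t • d)).hasGradientAt.hasFDerivAt.comp_hasDerivAt t hline

lemma add_inner_gradient_le_of_convexOn (hf : Differentiable ℝ f)
    (hc : ConvexOn ℝ Set.univ f) (x y : F) :
    f x + inner ℝ (gradient f x) (y - x) ≤ f y := by
  have hconv : ConvexOn ℝ Set.univ (fun t : ℝ => f (x + t • (y - x))) := by
    have := hc.comp_affineMap (AffineMap.lineMap x y : ℝ →ᵃ[ℝ] F)
    simpa [Function.comp_def, AffineMap.lineMap_apply, add_comm] using this
  have hslope := hconv.le_slope_of_hasDerivAt (Set.mem_univ 0) (Set.mem_univ 1) one_pos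
    (hasDerivAt_comp_line hf x (y - x) 0)
  simp only [slope_def_field, zero_smul, one_smul, add_zero, add_sub_cancel, sub_zero,
    div_one] at hslope
  linarith

lemma inner_gradient_line_sub_le (hL : ∀ x y, ‖gradient f x - gradient f y‖ ≤ L * ‖x - y‖)
    (x d : F) {t : ℝ} (ht : 0 ≤ t) :
    inner ℝ (gradient f (x + t • d)) d - inner ℝ (gradient f x) d ≤ L * t * ‖d‖ ^ 2 :=
  calc inner ℝ (gradient f (x + t • d)) d - inner ℝ (gradient f x) d
      = inner ℝ (gradient f (x + t • d) - gradient f x) d := inner_sub_left .. |>.symm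
    _ ≤ ‖gradient f (x + t • d) - gradient f x‖ * ‖d‖ := real_inner_le_norm _ _
    _ ≤ L * ‖x + t • d - x‖ * ‖d‖ := by gcongr; exact hL _ _
    _ = L * t * ‖d‖ ^ 2 := by
      rw [add_sub_cancel_left, norm_smul, Real.norm_of_nonneg ht]; ring

lemma le_add_inner_gradient_add_sq (hf : Differentiable ℝ f)
    (hL : ∀ x y, ‖gradient f x - gradient f y‖ ≤ L * ‖x - y‖) (x y : F) :
    f y ≤ f x + inner ℝ (gradient f x) (y - x) + L / 2 * ‖y - x‖ ^ 2 := by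
  obtain ⟨d, rfl⟩ : ∃ d, y = x + d := ⟨y - x, (add_sub_cancel x y).symm⟩
  rw [add_sub_cancel_left]
  let φ : ℝ → ℝ := fun t =>
    f (x + t • d) - t * inner ℝ (gradient f x) d - t ^ 2 * (L / 2 * ‖d‖ ^ 2)
  have hφ (t : ℝ) : HasDerivAt φ (inner ℝ (gradient f (x + t • d)) d - inner ℝ (gradient f x) d
      - 2 * t * (L / 2 * ‖d‖ ^ 2)) t := by
    have hlin := (hasDerivAt_id t).mul_const (inner ℝ (gradient f x) d)
    have hquad := (hasDerivAt_pow 2 t).mul_const (L / 2 * ‖d‖ ^ 2)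
    exact (((hasDerivAt_comp_line hf x d t).sub hlin).sub hquad).congr_deriv (by simp)
  have hanti : AntitoneOn φ (Set.Icc 0 1) := by
    refine antitoneOn_of_deriv_nonpos (convex_Icc 0 1)
      (fun t _ => (hφ t).continuousAt.continuousWithinAt)
      (fun t _ => (hφ t).differentiableAt.differentiableWithinAt) fun t ht => ?_
    rw [interior_Icc] at ht
    rw [(hφ t).deriv]
    linarith [inner_gradient_line_sub_le hL x d ht.1.le]
  have hφ01 : φ 1 ≤ φ 0 := hanti (by simp) (by simp) zero_le_one
  simp only [φ, one_smul, zero_smul, add_zero] at hφ01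
  linarith

lemma gradient_eq_zero_of_forall_le (hxs : ∀ x, f xs ≤ f x) : gradient f xs = 0 := by
  have : fderiv ℝ f xs = 0 := IsLocalMin.fderiv_eq_zero (Filter.Eventually.of_forall hxs)
  simp [gradient, this]

lemma norm_gradient_le_of_forall_le (hL : ∀ x y, ‖gradient f x - gradient f y‖ ≤ L * ‖x - y‖)
    (hxs : ∀ x, f xs ≤ f x) (x : F) : ‖gradient f x‖ ≤ L * ‖x - xs‖ := by
  simpa [gradient_eq_zero_of_forall_le hxs] using hL x xs

lemma norm_gradient_sq_le_of_forall_le (hL0 : 0 < L) (hf : Differentiable ℝ f)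
    (hL : ∀ x y, ‖gradient f x - gradient f y‖ ≤ L * ‖x - y‖) (hxs : ∀ x, f xs ≤ f x) (x : F) :
    ‖gradient f x‖ ^ 2 ≤ 2 * L * (f x - f xs) := by
  -- The minimum is at most the value after a gradient step of length `1 / L`.
  have hstep := (hxs _).trans
    (le_add_inner_gradient_add_sq hf hL x (x - L⁻¹ • gradient f x))
  rw [sub_sub_cancel_left, inner_neg_right, norm_neg, inner_smul_right, norm_smul,
    real_inner_self_eq_norm_sq, Real.norm_of_nonneg (inv_nonneg.2 hL0.le)] at hstep
  have hquad : L / 2 * (L⁻¹ * ‖gradient f x‖) ^ 2 = L⁻¹ * ‖gradient f x‖ ^ 2 / 2 := by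
    field_simp
  have hdecr : L⁻¹ * ‖gradient f x‖ ^ 2 ≤ 2 * (f x - f xs) := by linarith
  rw [inv_mul_le_iff₀ hL0] at hdecr
  linarith

end SmoothConvex

section SimilarTriangles

variable {F : Type*}

/-- The mean of `y` and `z` with weights `A` and `α`. Both `x^{k+1}` and `y^{k+1}` are of this
form, with `z = zᵏ` and `z = z^{k+1}`. It is only meaningful for `A + α ≠ 0`. -/
noncomputable def weightedMean [AddCommGroup F] [Module ℝ F] (A α : ℝ) (y z : F) : F :=
  (A + α)⁻¹ • (A • y + α • z)

section Module

variable [AddCommGroup F] [Module ℝ F] {A α : ℝ}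

lemma weightedMean_self (h : A + α ≠ 0) (y : F) : weightedMean A α y y = y := by
  rw [weightedMean, ← add_smul, inv_smul_smul₀ h]

lemma weightedMean_sub_weightedMean (A α : ℝ) (y z z' : F) :
    weightedMean A α y z' - weightedMean A α y z = (α / (A + α)) • (z' - z) := by
  rw [weightedMean, weightedMean, ← smul_sub, add_sub_add_left_eq_sub, ← smul_sub, smul_smul,
    div_eq_inv_mul]

lemma weightedMean_sub_left (h : A + α ≠ 0) (y z : F) :
    weightedMean A α y z - y = (α / (A + α)) • (z - y) := by
  simpa only [weightedMean_self h] using weightedMean_sub_weightedMean A α y y z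

lemma smul_sub_weightedMean (h : A + α ≠ 0) (y z : F) :
    A • (y - weightedMean A α y z) = α • (weightedMean A α y z - z) := by
  have : (A + α) • weightedMean A α y z = A • y + α • z := smul_inv_smul₀ h _
  rw [add_smul] at this
  rw [smul_sub, smul_sub, sub_eq_sub_iff_add_eq_add, ← this, add_comm]

lemma weightedMean_mem {s : Set F} (hs : Convex ℝ s) (hA : 0 ≤ A) (hα : 0 ≤ α) (h : 0 < A + α)
    {y z : F} (hy : y ∈ s) (hz : z ∈ s) : weightedMean A α y z ∈ s := by
  have := convex_iff_div.1 hs hy hz hA hα h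
  rwa [div_eq_inv_mul, div_eq_inv_mul, mul_smul, mul_smul, ← smul_add] at this

end Module

variable [NormedAddCommGroup F] [InnerProductSpace ℝ F] {f : F → ℝ} {L A α : ℝ}

lemma norm_weightedMean_sub_le (hA : 0 ≤ A) (hα : 0 ≤ α) (h : 0 < A + α) {y z u : F} {ρ : ℝ}
    (hy : ‖y - u‖ ≤ ρ) (hz : ‖z - u‖ ≤ ρ) : ‖weightedMean A α y z - u‖ ≤ ρ := by
  rw [← mem_closedBall_iff_norm] at hy hz ⊢
  exact weightedMean_mem (convex_closedBall u ρ) hA hα h hy hz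

/-- The error that a step of size `α` along a gradient perturbed by `θ` adds to the energy
estimate, where `w` points from the current `z` to the reference point. -/
def stepError (α : ℝ) (θ w : F) : ℝ := α * inner ℝ θ w + α ^ 2 * ‖θ‖ ^ 2

variable [CompleteSpace F]

lemma weightedMean_mul_add_inner_gradient_le (hf : Differentiable ℝ f)
    (hc : ConvexOn ℝ Set.univ f) (hA : 0 ≤ A) (hα : 0 ≤ α) (h : A + α ≠ 0) (u y z : F) :
    (A + α) * f (weightedMean A α y z)
        + α * inner ℝ (gradient f (weightedMean A α y z)) (u - z) ≤ A * f y + α * f u := by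
  set x := weightedMean A α y z
  have hy := mul_le_mul_of_nonneg_left (add_inner_gradient_le_of_convexOn hf hc x y) hA
  have hu := mul_le_mul_of_nonneg_left (add_inner_gradient_le_of_convexOn hf hc x u) hα
  have hinner : A * inner ℝ (gradient f x) (y - x) + α * inner ℝ (gradient f x) (u - x)
      = α * inner ℝ (gradient f x) (u - z) := by
    rw [← inner_smul_right, smul_sub_weightedMean h, inner_smul_right, ← mul_add,
      ← inner_add_right, add_comm, sub_add_sub_cancel]
  linarith

lemma mul_apply_weightedMean_sub_smul_le (hf : Differentiable ℝ f)
    (hL : ∀ x y, ‖gradient f x - gradient f y‖ ≤ L * ‖x - y‖) (h : 0 < A + α)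
    (hLα : 2 * L * α ^ 2 ≤ A + α) (y z g : F) :
    (A + α) * f (weightedMean A α y (z - α • g)) ≤ (A + α) * f (weightedMean A α y z)
      - α ^ 2 * inner ℝ (gradient f (weightedMean A α y z)) g + α ^ 2 * ‖g‖ ^ 2 / 4 := by
  set x := weightedMean A α y z with hx
  have hdisp : weightedMean A α y (z - α • g) - x = (-(α ^ 2 / (A + α))) • g := by
    rw [hx, weightedMean_sub_weightedMean, sub_sub_cancel_left, smul_neg, smul_smul, neg_smul]
    congr 2; ring
  have hstep := le_add_inner_gradient_add_sq hf hL x (weightedMean A α y (z - α • g))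
  rw [hdisp, inner_smul_right, norm_smul, mul_pow, Real.norm_eq_abs, sq_abs] at hstep
  calc (A + α) * f (weightedMean A α y (z - α • g))
      ≤ (A + α) * (f x + -(α ^ 2 / (A + α)) * inner ℝ (gradient f x) g
          + L / 2 * ((-(α ^ 2 / (A + α))) ^ 2 * ‖g‖ ^ 2)) := by gcongr
    _ = (A + α) * f x - α ^ 2 * inner ℝ (gradient f x) g
          + 2 * L * α ^ 2 / (A + α) * (α ^ 2 * ‖g‖ ^ 2 / 4) := by field_simp; ring
    _ ≤ (A + α) * f x - α ^ 2 * inner ℝ (gradient f x) g + 1 * (α ^ 2 * ‖g‖ ^ 2 / 4) := by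
      gcongr; exact (div_le_one h).2 hLα
    _ = _ := by ring

lemma similar_triangles_step (hf : Differentiable ℝ f) (hc : ConvexOn ℝ Set.univ f)
    (hL : ∀ x y, ‖gradient f x - gradient f y‖ ≤ L * ‖x - y‖) (hA : 0 ≤ A) (hα : 0 < α)
    (hLα : 2 * L * α ^ 2 ≤ A + α) (u y z g : F) :
    (A + α) * (f (weightedMean A α y (z - α • g)) - f u) + ‖z - α • g - u‖ ^ 2 / 2
      ≤ A * (f y - f u) + ‖z - u‖ ^ 2 / 2
        + stepError α (g - gradient f (weightedMean A α y z)) (u - z) := by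
  have hAα : 0 < A + α := by linarith
  have hconvex := weightedMean_mul_add_inner_gradient_le hf hc hA hα.le hAα.ne' u y z
  have hdescent := mul_apply_weightedMean_sub_smul_le hf hL hAα hLα y z g
  set v := gradient f (weightedMean A α y z)
  have hdist : ‖z - α • g - u‖ ^ 2 = ‖z - u‖ ^ 2 + 2 * α * inner ℝ g (u - z)
      + α ^ 2 * ‖g‖ ^ 2 := by
    rw [sub_right_comm, norm_sub_sq_real, inner_smul_right, norm_smul, mul_pow,
      Real.norm_eq_abs, sq_abs, real_inner_comm, ← neg_sub u z, inner_neg_right]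
    ring
  have hinner : inner ℝ (g - v) (u - z) = inner ℝ g (u - z) - inner ℝ v (u - z) :=
    inner_sub_left ..
  have hsq : 3 / 4 * ‖g‖ ^ 2 - inner ℝ v g ≤ ‖g - v‖ ^ 2 := by
    have hpos := sq_nonneg ‖g - (2 : ℝ) • v‖
    rw [norm_sub_sq_real, inner_smul_right, norm_smul, mul_pow, Real.norm_ofNat] at hpos
    rw [norm_sub_sq_real, real_inner_comm g v]
    linarith
  have hsq' := mul_le_mul_of_nonneg_left hsq (sq_nonneg α)
  rw [stepError, hdist, hinner]
  linarith

end SimilarTriangles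

section Clip

variable {n : ℕ} {lam : ℝ} {g v : E n}

lemma clip_of_norm_le (h : ‖g‖ ≤ lam) : clip g lam = g := by
  rcases eq_or_ne g 0 with rfl | hg
  · simp [clip]
  · rw [clip, min_eq_left ((one_le_div (norm_pos_iff.2 hg)).2 h), one_smul]

lemma clip_of_lt_norm (h0 : 0 ≤ lam) (h : lam < ‖g‖) : clip g lam = (lam / ‖g‖) • g := by
  rw [clip, min_eq_right ((div_le_one (h0.trans_lt h)).2 h.le)]

lemma norm_clip_le (h0 : 0 ≤ lam) (g : E n) : ‖clip g lam‖ ≤ lam := by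
  rcases le_or_gt ‖g‖ lam with h | h
  · rwa [clip_of_norm_le h]
  · rw [clip_of_lt_norm h0 h, norm_smul, Real.norm_of_nonneg (by positivity),
      div_mul_cancel₀ _ (h0.trans_lt h).ne']

lemma norm_clip_sub_le (hv : ‖v‖ ≤ lam) (g : E n) : ‖clip g lam - v‖ ≤ ‖g - v‖ := by
  have h0 : 0 ≤ lam := (norm_nonneg v).trans hv
  rcases le_or_gt ‖g‖ lam with h | h
  · rw [clip_of_norm_le h]
  have hg : 0 < ‖g‖ := h0.trans_lt h
  rw [clip_of_lt_norm h0 h]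
  refine le_of_sq_le_sq ?_ (norm_nonneg _)
  set κ := lam / ‖g‖
  have hκg : κ * ‖g‖ = lam := div_mul_cancel₀ _ hg.ne'
  have hκ1 : κ ≤ 1 := (div_le_one hg).2 h.le
  have hinner : (1 - κ) * inner ℝ g v ≤ (1 - κ) * (‖g‖ * lam) :=
    mul_le_mul_of_nonneg_left
      ((real_inner_le_norm g v).trans (mul_le_mul_of_nonneg_left hv hg.le)) (sub_nonneg.2 hκ1)
  rw [norm_sub_sq_real, norm_sub_sq_real, real_inner_smul_left, norm_smul,
    Real.norm_of_nonneg (by positivity : 0 ≤ κ), hκg]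
  nlinarith [sq_nonneg (‖g‖ - lam)]

lemma norm_clip_sub_self_le (h0 : 0 < lam) (hv : ‖v‖ ≤ lam / 2) (g : E n) :
    ‖clip g lam - g‖ ≤ ‖g - v‖ ^ 2 / (2 * lam) := by
  rcases le_or_gt ‖g‖ lam with h | h
  · rw [clip_of_norm_le h, sub_self, norm_zero]
    positivity
  have hg : 0 < ‖g‖ := h0.trans h
  have hκ1 : lam / ‖g‖ ≤ 1 := (div_le_one hg).2 h.le
  have hscale : clip g lam - g = (lam / ‖g‖ - 1) • g := by
    rw [clip_of_lt_norm h0.le h, sub_smul, one_smul]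
  have hexcess : ‖clip g lam - g‖ = ‖g‖ - lam := by
    rw [hscale, norm_smul, Real.norm_of_nonpos (by linarith), neg_sub, sub_mul, one_mul,
      div_mul_cancel₀ _ hg.ne']
  have hgv : ‖g‖ ≤ ‖g - v‖ + lam / 2 := by linarith [norm_le_norm_sub_add g v]
  rw [hexcess, le_div_iff₀ (by positivity)]
  nlinarith [sq_nonneg (‖g - v‖ - lam)]

end Clip

section Stepsizes

variable {a L : ℝ}

lemma bigA_eq (a L : ℝ) (k : ℕ) : bigA a L k = k * (k + 3) / (4 * a * L) := by
  induction k with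
  | zero => simp [bigA]
  | succ k ih =>
    rw [bigA, ih, alpha]
    push_cast
    rcases eq_or_ne a 0 with rfl | ha
    · simp
    rcases eq_or_ne L 0 with rfl | hL
    · simp
    field_simp
    ring

lemma alpha_succ_pos (ha : 0 < a) (hL : 0 < L) (k : ℕ) : 0 < alpha a L (k + 1) := by
  rw [alpha]; positivity

lemma bigA_nonneg (ha : 0 < a) (hL : 0 < L) (k : ℕ) : 0 ≤ bigA a L k := by
  rw [bigA_eq]; positivity

lemma bigA_pos (ha : 0 < a) (hL : 0 < L) {k : ℕ} (hk : 0 < k) : 0 < bigA a L k := by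
  rw [bigA_eq]; positivity

lemma two_mul_mul_alpha_sq_le (ha : 2 ≤ a) (hL : 0 < L) (k : ℕ) :
    2 * L * alpha a L (k + 1) ^ 2 ≤ bigA a L (k + 1) := by
  have ha0 : 0 < a := by linarith
  have hk : (0 : ℝ) ≤ k := k.cast_nonneg
  calc 2 * L * alpha a L (k + 1) ^ 2 = 2 * (k + 2) ^ 2 / a / (4 * a * L) := by
        rw [alpha]; field_simp; ring
    _ ≤ (k + 1) * (k + 4) / (4 * a * L) := by
      gcongr
      rw [div_le_iff₀ ha0]
      nlinarith [mul_nonneg hk hk,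
        mul_nonneg (sub_nonneg.2 ha) (by positivity : (0 : ℝ) ≤ (k + 1) * (k + 4))]
    _ = bigA a L (k + 1) := by rw [bigA_eq]; push_cast; ring

lemma mul_alpha_sq_le_mul_bigA (ha : 0 < a) (hL : 0 < L) {k : ℕ} (hk : 0 < k) :
    a * (L * alpha a L (k + 1) ^ 2) ≤ 9 / 4 * bigA a L k := by
  have hk1 : (1 : ℝ) ≤ k := Nat.one_le_cast.2 hk
  calc a * (L * alpha a L (k + 1) ^ 2) = (k + 2) ^ 2 / (4 * a * L) := by
        rw [alpha]; field_simp; ring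
    _ ≤ 9 / 4 * (k * (k + 3)) / (4 * a * L) := by gcongr; nlinarith
    _ = 9 / 4 * bigA a L k := by rw [bigA_eq]; ring

end Stepsizes

section GradientBound

variable {F : Type*} [NormedAddCommGroup F] [InnerProductSpace ℝ F] [CompleteSpace F]
  {f : F → ℝ} {L A α ρ : ℝ}

lemma norm_gradient_weightedMean_le (hL0 : 0 < L) (hf : Differentiable ℝ f)
    (hL : ∀ x y, ‖gradient f x - gradient f y‖ ≤ L * ‖x - y‖) {xs : F} (hxs : ∀ x, f xs ≤ f x)
    (hA : 0 < A) (hα : 0 ≤ α) {y z : F} (hy : ‖y - xs‖ ≤ ρ) (hz : ‖z - xs‖ ≤ ρ)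
    (hfy : A * (f y - f xs) ≤ ρ ^ 2 / 2) :
    ‖gradient f (weightedMean A α y z)‖ ≤ ρ * √(L / A) * (2 * (α * √(L / A)) + 1) := by
  have hρ : 0 ≤ ρ := (norm_nonneg _).trans hy
  have hq2 : √(L / A) ^ 2 = L / A := Real.sq_sqrt (by positivity)
  have hyz : ‖z - y‖ ≤ 2 * ρ := by
    rw [← sub_sub_sub_cancel_right z y xs]
    exact (norm_sub_le _ _).trans (by linarith)
  have hxy : ‖weightedMean A α y z - y‖ ≤ α / A * (2 * ρ) := by
    rw [weightedMean_sub_left (by positivity), norm_smul, Real.norm_of_nonneg (by positivity)]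
    gcongr
    linarith
  have hdiff : ‖gradient f (weightedMean A α y z) - gradient f y‖
      ≤ 2 * ρ * α * √(L / A) ^ 2 :=
    calc _ ≤ L * (α / A * (2 * ρ)) := (hL _ _).trans (by gcongr)
      _ = _ := by rw [hq2]; ring
  have hgrad : ‖gradient f y‖ ≤ ρ * √(L / A) := by
    refine le_of_sq_le_sq ?_ (by positivity)
    refine (norm_gradient_sq_le_of_forall_le hL0 hf hL hxs y).trans ?_
    rw [mul_pow, hq2, mul_div_assoc', le_div_iff₀ hA]
    nlinarith
  calc _ ≤ _ := norm_le_norm_sub_add _ (gradient f y)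
    _ ≤ 2 * ρ * α * √(L / A) ^ 2 + ρ * √(L / A) := add_le_add hdiff hgrad
    _ = _ := by ring

/-- The positive root `u` of `u² = 2 l (2 u + 1)`. The stepsize parameter is at least `36 u²`,
which keeps gradients below half of the clipping level. -/
noncomputable def stepRoot (l : ℝ) : ℝ := 2 * l + √(4 * l ^ 2 + 2 * l)

lemma stepRoot_sq {l : ℝ} (hl : 0 ≤ l) : stepRoot l ^ 2 = 2 * l * (2 * stepRoot l + 1) := by
  have : √(4 * l ^ 2 + 2 * l) ^ 2 = 4 * l ^ 2 + 2 * l := Real.sq_sqrt (by positivity)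
  rw [stepRoot]
  linarith

lemma four_mul_le_stepRoot {l : ℝ} (hl : 0 ≤ l) : 4 * l ≤ stepRoot l := by
  have : 2 * l ≤ √(4 * l ^ 2 + 2 * l) := Real.le_sqrt_of_sq_le (by nlinarith)
  rw [stepRoot]
  linarith

lemma alpha_mul_sqrt_le {a u : ℝ} (hL : 0 < L) (hu : 0 < u) (ha : 36 * u ^ 2 ≤ a) {k : ℕ}
    (hk : 0 < k) : alpha a L (k + 1) * √(L / bigA a L k) ≤ 1 / (4 * u) := by
  have ha0 : 0 < a := lt_of_lt_of_le (by positivity) ha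
  have hA := bigA_pos ha0 hL hk
  refine le_of_sq_le_sq ?_ (by positivity)
  rw [mul_pow, Real.sq_sqrt (by positivity), div_pow, one_pow, mul_div_assoc',
    div_le_div_iff₀ hA (by positivity)]
  have hmono : 36 * u ^ 2 * (L * alpha a L (k + 1) ^ 2) ≤ a * (L * alpha a L (k + 1) ^ 2) := by
    gcongr
  linarith [mul_alpha_sq_le_mul_bigA ha0 hL hk]

end GradientBound

section Trajectory

variable {n : ℕ} {Ξ : Type u} {f : E n → ℝ} {G : E n → Ξ → E n} {a L B b ρ : ℝ} {m : ℕ → ℕ}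
  {x0 xs : E n} {k : ℕ} {p : E n × E n}

/-- The extrapolation point `x^{k+1}` determined by the pair `(yᵏ, zᵏ)`. -/
noncomputable def extrapolation (a L : ℝ) (k : ℕ) (p : E n × E n) : E n :=
  weightedMean (bigA a L k) (alpha a L (k + 1)) p.1 p.2

/-- The Lyapunov function of the method at the pair `(yᵏ, zᵏ)`. -/
noncomputable def energy (f : E n → ℝ) (a L : ℝ) (xs : E n) (k : ℕ) (p : E n × E n) : ℝ :=
  bigA a L k * (f p.1 - f xs) + ‖p.2 - xs‖ ^ 2 / 2

/-- The error term contributed by iteration `k`, with samples `s`, to the energy estimate. -/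
noncomputable def noise (f : E n → ℝ) (G : E n → Ξ → E n) (a L B : ℝ) (m : ℕ → ℕ) (xs : E n)
    (k : ℕ) (p : E n × E n) (s : ℕ → Ξ) : ℝ :=
  stepError (alpha a L (k + 1))
    (clip (miniBatch G (extrapolation a L k p) (m k) s) (B / alpha a L (k + 1))
      - gradient f (extrapolation a L k p))
    (xs - p.2)

/-- The region in which the exact gradient at the extrapolation point is well below the clipping
level. -/
def InRegion (f : E n → ℝ) (a L ρ : ℝ) (xs : E n) (k : ℕ) (p : E n × E n) : Prop :=
  ‖p.1 - xs‖ ≤ ρ ∧ ‖p.2 - xs‖ ≤ ρ ∧ bigA a L k * (f p.1 - f xs) ≤ ρ ^ 2 / 2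

open Classical in
/-- The noise of iteration `k`, switched off once the accumulated noise `q.2` exceeds `b` or the
iterates `q.1` are outside the region. -/
noncomputable def gatedNoise (f : E n → ℝ) (G : E n → Ξ → E n) (a L B : ℝ) (m : ℕ → ℕ)
    (xs : E n) (ρ b : ℝ) (k : ℕ) (q : (E n × E n) × ℝ) (s : ℕ → Ξ) : ℝ :=
  if q.2 ≤ b ∧ InRegion f a L ρ xs k q.1 then noise f G a L B m xs k q.1 s else 0

/-- The accumulated noise, frozen once it exceeds `b` or the iterates leave the region. -/
noncomputable def stoppedNoise (f : E n → ℝ) (G : E n → Ξ → E n) (a L B : ℝ) (m : ℕ → ℕ)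
    (x0 xs : E n) (ρ b : ℝ) (s : ℕ → ℕ → Ξ) : ℕ → ℝ
  | 0 => 0
  | k + 1 => stoppedNoise f G a L B m x0 xs ρ b s k +
      gatedNoise f G a L B m xs ρ b k
        (iterates G a L B m x0 s k, stoppedNoise f G a L B m x0 xs ρ b s k) (s k)

lemma norm_gradient_extrapolation_le (hf : IsSmooth L f) (hxs : ∀ x, f xs ≤ f x) (hL : 0 < L)
    {l : ℝ} (hl : 1 ≤ l) (ha : 36 * stepRoot l ^ 2 ≤ a) (hp : InRegion f a L ρ xs k p) :
    ‖gradient f (extrapolation a L k p)‖ ≤ ρ / (8 * l) / alpha a L (k + 1) / 2 := by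
  obtain ⟨hy, hz, hfy⟩ := hp
  have hρ : 0 ≤ ρ := (norm_nonneg _).trans hy
  have hu : 4 * l ≤ stepRoot l := four_mul_le_stepRoot (by linarith)
  have hu0 : 0 < stepRoot l := by linarith
  have ha0 : 0 < a := lt_of_lt_of_le (by positivity) ha
  have hα := alpha_succ_pos ha0 hL k
  rw [div_div, div_div, le_div_iff₀ (by positivity)]
  rcases k.eq_zero_or_pos with rfl | hk
  · -- `A₀ = 0`, so the function value does not control the gradient at `y⁰`.
    have hgrad : ‖gradient f (extrapolation a L 0 p)‖ ≤ L * ρ :=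
      (norm_gradient_le_of_forall_le hf.2 hxs _).trans <| mul_le_mul_of_nonneg_left
        (norm_weightedMean_sub_le le_rfl hα.le (by simpa [bigA] using hα) hy hz) hL.le
    have hα1 : alpha a L (0 + 1) = 1 / (a * L) := by simp [alpha]; field_simp
    calc _ ≤ L * ρ * (8 * l * (alpha a L (0 + 1) * 2)) := by gcongr
      _ = ρ * (16 * l) / a := by rw [hα1]; field_simp; ring
      _ ≤ ρ := by rw [div_le_iff₀ ha0]; gcongr; nlinarith
  · have hgrad := norm_gradient_weightedMean_le hL hf.1 hf.2 hxs (bigA_pos ha0 hL hk) hα.le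
      hy hz hfy
    have hαq := alpha_mul_sqrt_le hL hu0 ha hk
    set q := √(L / bigA a L k)
    set α := alpha a L (k + 1)
    set u := stepRoot l
    calc _ ≤ ρ * q * (2 * (α * q) + 1) * (8 * l * (α * 2)) := by gcongr; exact hgrad
      _ = ρ * (16 * l * (α * q * (2 * (α * q) + 1))) := by ring
      _ ≤ ρ * (16 * l * (1 / (4 * u) * (2 * (1 / (4 * u)) + 1))) := by gcongr
      _ = ρ * ((2 * l * (2 * u + 1)) / u ^ 2) := by field_simp; ring
      _ = ρ := by rw [← stepRoot_sq (by linarith), div_self (by positivity), mul_one]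

lemma iterates_succ (s : ℕ → ℕ → Ξ) (k : ℕ) :
    iterates G a L B m x0 s (k + 1) =
      let p := iterates G a L B m x0 s k
      let z' := p.2 - alpha a L (k + 1) • clip (miniBatch G (extrapolation a L k p) (m k) (s k))
        (B / alpha a L (k + 1))
      (extrapolation a L k (p.1, z'), z') := rfl

lemma energy_iterates_succ_le (hf : IsSmooth L f) (hc : ConvexOn ℝ Set.univ f) (ha : 2 ≤ a)
    (hL : 0 < L) (xs : E n) (s : ℕ → ℕ → Ξ) (k : ℕ) :
    energy f a L xs (k + 1) (iterates G a L B m x0 s (k + 1))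
      ≤ energy f a L xs k (iterates G a L B m x0 s k)
        + noise f G a L B m xs k (iterates G a L B m x0 s k) (s k) :=
  have ha0 : 0 < a := by linarith
  similar_triangles_step hf.1 hc hf.2 (bigA_nonneg ha0 hL k) (alpha_succ_pos ha0 hL k)
    (two_mul_mul_alpha_sq_le ha hL k) xs _ _ _

lemma bigA_mul_sub_nonneg (ha : 0 < a) (hL : 0 < L) (hxs : ∀ x, f xs ≤ f x) (k : ℕ) (y : E n) :
    0 ≤ bigA a L k * (f y - f xs) :=
  mul_nonneg (bigA_nonneg ha hL k) (sub_nonneg.2 (hxs y))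

lemma norm_snd_sub_le_of_energy_le (ha : 0 < a) (hL : 0 < L) (hxs : ∀ x, f xs ≤ f x)
    (hρ : 0 ≤ ρ) (h : energy f a L xs k p ≤ ρ ^ 2 / 2) : ‖p.2 - xs‖ ≤ ρ := by
  rw [energy] at h
  exact le_of_sq_le_sq (by linarith [bigA_mul_sub_nonneg ha hL hxs k p.1]) hρ

lemma inRegion_of_energy_le (ha : 0 < a) (hL : 0 < L) (hxs : ∀ x, f xs ≤ f x)
    (hy : ‖p.1 - xs‖ ≤ ρ) (h : energy f a L xs k p ≤ ρ ^ 2 / 2) : InRegion f a L ρ xs k p := by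
  refine ⟨hy, norm_snd_sub_le_of_energy_le ha hL hxs ((norm_nonneg _).trans hy) h, ?_⟩
  rw [energy] at h
  linarith [sq_nonneg ‖p.2 - xs‖]

lemma InRegion.iterates_succ (ha : 0 < a) (hL : 0 < L) (hxs : ∀ x, f xs ≤ f x)
    {s : ℕ → ℕ → Ξ} (hk : InRegion f a L ρ xs k (iterates G a L B m x0 s k))
    (h : energy f a L xs (k + 1) (iterates G a L B m x0 s (k + 1)) ≤ ρ ^ 2 / 2) :
    InRegion f a L ρ xs (k + 1) (iterates G a L B m x0 s (k + 1)) := by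
  have hz := norm_snd_sub_le_of_energy_le ha hL hxs ((norm_nonneg _).trans hk.1) h
  exact inRegion_of_energy_le ha hL hxs (norm_weightedMean_sub_le (bigA_nonneg ha hL k)
    (alpha_succ_pos ha hL k).le (bigA_pos ha hL k.succ_pos) hk.1 hz) h

lemma energy_le_add_stoppedNoise_and_inRegion (hf : IsSmooth L f) (hc : ConvexOn ℝ Set.univ f)
    (hxs : ∀ x, f xs ≤ f x) (ha : 2 ≤ a) (hL : 0 < L) (hb : 0 ≤ b) (hρ0 : 0 ≤ ρ)
    (hρ : ‖x0 - xs‖ ^ 2 + 2 * b ≤ ρ ^ 2) (s : ℕ → ℕ → Ξ) (k : ℕ)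
    (h : stoppedNoise f G a L B m x0 xs ρ b s k ≤ b) :
    energy f a L xs k (iterates G a L B m x0 s k)
        ≤ ‖x0 - xs‖ ^ 2 / 2 + stoppedNoise f G a L B m x0 xs ρ b s k ∧
      InRegion f a L ρ xs k (iterates G a L B m x0 s k) := by
  have ha0 : 0 < a := by linarith
  induction k with
  | zero =>
    have henergy : energy f a L xs 0 (x0, x0) = ‖x0 - xs‖ ^ 2 / 2 := by simp [energy, bigA]
    have hy : ‖x0 - xs‖ ≤ ρ := le_of_sq_le_sq (by linarith) hρ0
    rw [iterates, stoppedNoise]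
    exact ⟨by linarith, inRegion_of_energy_le ha0 hL hxs hy (by linarith)⟩
  | succ k ih =>
    have hk : stoppedNoise f G a L B m x0 xs ρ b s k ≤ b := by
      by_contra hk
      rw [stoppedNoise, gatedNoise, if_neg fun h => hk h.1, add_zero] at h
      exact hk h
    obtain ⟨ih_energy, ih_region⟩ := ih hk
    have hS : stoppedNoise f G a L B m x0 xs ρ b s (k + 1)
        = stoppedNoise f G a L B m x0 xs ρ b s k
          + noise f G a L B m xs k (iterates G a L B m x0 s k) (s k) := by
      rw [stoppedNoise, gatedNoise, if_pos ⟨hk, ih_region⟩]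
    have henergy : energy f a L xs (k + 1) (iterates G a L B m x0 s (k + 1))
        ≤ ‖x0 - xs‖ ^ 2 / 2 + stoppedNoise f G a L B m x0 xs ρ b s (k + 1) := by
      linarith [energy_iterates_succ_le (G := G) (B := B) (m := m) (x0 := x0) hf hc ha hL xs s k]
    exact ⟨henergy, ih_region.iterates_succ ha0 hL hxs (by linarith)⟩

lemma output_sub_le (hf : IsSmooth L f) (hc : ConvexOn ℝ Set.univ f)
    (hxs : ∀ x, f xs ≤ f x) (ha : 2 ≤ a) (hL : 0 < L) (hb : 0 ≤ b) (hρ0 : 0 ≤ ρ)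
    (hρ : ‖x0 - xs‖ ^ 2 + 2 * b ≤ ρ ^ 2) (s : ℕ → ℕ → Ξ) (k : ℕ)
    (h : stoppedNoise f G a L B m x0 xs ρ b s k ≤ b) :
    bigA a L k * (f (output G a L B m x0 s k) - f xs) ≤ ρ ^ 2 / 2 :=
  (energy_le_add_stoppedNoise_and_inRegion hf hc hxs ha hL hb hρ0 hρ s k h).2.2.2

end Trajectory

section ClippedStep

lemma abs_stepError_le {F : Type*} [NormedAddCommGroup F] [InnerProductSpace ℝ F] {α : ℝ}
    (hα : 0 ≤ α) (θ w : F) : |stepError α θ w| ≤ α * ‖θ‖ * (‖w‖ + α * ‖θ‖) :=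
  calc |stepError α θ w| ≤ |α * inner ℝ θ w| + |α ^ 2 * ‖θ‖ ^ 2| := abs_add_le _ _
    _ = α * |inner ℝ θ w| + α ^ 2 * ‖θ‖ ^ 2 := by
      rw [abs_mul, abs_of_nonneg hα, abs_of_nonneg (by positivity : 0 ≤ α ^ 2 * ‖θ‖ ^ 2)]
    _ ≤ α * (‖θ‖ * ‖w‖) + α ^ 2 * ‖θ‖ ^ 2 := by gcongr; exact abs_real_inner_le_norm _ _
    _ = α * ‖θ‖ * (‖w‖ + α * ‖θ‖) := by ring

variable {n : ℕ} {g v w : E n} {α B ρ l lam : ℝ}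

lemma inner_clip_sub_le (h0 : 0 < lam) (hv : ‖v‖ ≤ lam / 2) (hw : ‖w‖ ≤ ρ) :
    inner ℝ (clip g lam - v) w ≤ inner ℝ (g - v) w + ‖g - v‖ ^ 2 / (2 * lam) * ρ :=
  calc inner ℝ (clip g lam - v) w = inner ℝ (g - v) w + inner ℝ (clip g lam - g) w := by
        rw [← inner_add_left, add_comm (g - v), sub_add_sub_cancel]
    _ ≤ inner ℝ (g - v) w + ‖clip g lam - g‖ * ‖w‖ := by gcongr; exact real_inner_le_norm _ _
    _ ≤ _ := by gcongr; exact norm_clip_sub_self_le h0 hv g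

lemma stepError_clip_le (hα : 0 < α) (hB : 0 < B) (hv : ‖v‖ ≤ B / α / 2) (hw : ‖w‖ ≤ ρ) :
    stepError α (clip g (B / α) - v) w
      ≤ α * inner ℝ (g - v) w + α ^ 2 * ‖g - v‖ ^ 2 * (ρ / (2 * B) + 1) := by
  have hlam : 0 < B / α := by positivity
  have hdist : ‖clip g (B / α) - v‖ ≤ ‖g - v‖ := norm_clip_sub_le (by linarith) g
  calc stepError α (clip g (B / α) - v) w
      ≤ α * (inner ℝ (g - v) w + ‖g - v‖ ^ 2 / (2 * (B / α)) * ρ) + α ^ 2 * ‖g - v‖ ^ 2 := by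
        rw [stepError]
        gcongr
        exact inner_clip_sub_le hlam hv hw
    _ = _ := by field_simp; ring

lemma mul_norm_clip_sub_le (hα : 0 < α) (hB : 0 ≤ B) (hv : ‖v‖ ≤ B / α / 2) :
    α * ‖clip g (B / α) - v‖ ≤ 3 / 2 * B := by
  have hclip : ‖clip g (B / α)‖ ≤ B / α := norm_clip_le (by positivity) g
  calc α * ‖clip g (B / α) - v‖ ≤ α * (B / α + B / α / 2) := by
        gcongr; exact (norm_sub_le _ _).trans (add_le_add hclip hv)
    _ = 3 / 2 * B := by field_simp; norm_num

lemma exp_stepError_clip_le (hα : 0 < α) (hρ : 0 < ρ) (hl : 2 ≤ l)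
    (hv : ‖v‖ ≤ ρ / (8 * l) / α / 2) (hw : ‖w‖ ≤ ρ) :
    Real.exp (4 * l / ρ ^ 2 * stepError α (clip g (ρ / (8 * l) / α) - v) w)
      ≤ 1 + 4 * l / ρ ^ 2 * α * inner ℝ (g - v) w
        + 38 * l ^ 2 / ρ ^ 2 * α ^ 2 * ‖g - v‖ ^ 2 := by
  have hlam : 0 < ρ / (8 * l) / α := by positivity
  set c := 4 * l / ρ ^ 2 with hc
  set θ := clip g (ρ / (8 * l) / α) - v
  have hθg : ‖θ‖ ≤ ‖g - v‖ := norm_clip_sub_le (by linarith) g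
  have hθ : α * ‖θ‖ ≤ 3 / 2 * (ρ / (8 * l)) := mul_norm_clip_sub_le hα (by positivity) hv
  have hθρ : α * ‖θ‖ ≤ 3 / 32 * ρ :=
    calc α * ‖θ‖ ≤ 3 / 2 * (ρ / (8 * 2)) := hθ.trans (by gcongr)
      _ = 3 / 32 * ρ := by ring
  have habs : |stepError α θ w| ≤ α * ‖θ‖ * (35 / 32 * ρ) :=
    (abs_stepError_le hα.le θ w).trans (by gcongr; linarith)
  have hcU : |c * stepError α θ w| ≤ 1 :=
    calc |c * stepError α θ w| ≤ c * (3 / 2 * (ρ / (8 * l)) * (35 / 32 * ρ)) := by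
          rw [abs_mul, abs_of_pos (by positivity : 0 < c)]
          gcongr
          exact habs.trans (by gcongr)
      _ = 105 / 128 := by rw [hc]; field_simp; norm_num
      _ ≤ 1 := by norm_num
  have hsq : stepError α θ w ^ 2 ≤ (α * ‖g - v‖ * (35 / 32 * ρ)) ^ 2 :=
    sq_le_sq' (by linarith [neg_abs_le (stepError α θ w), habs.trans (by gcongr :
      α * ‖θ‖ * (35 / 32 * ρ) ≤ α * ‖g - v‖ * (35 / 32 * ρ))])
      ((le_abs_self _).trans (habs.trans (by gcongr)))
  have hexp := (abs_le.1 (Real.abs_exp_sub_one_sub_id_le hcU)).2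
  calc Real.exp (c * stepError α θ w)
      ≤ 1 + c * stepError α θ w + c ^ 2 * stepError α θ w ^ 2 := by linarith
    _ ≤ 1 + c * (α * inner ℝ (g - v) w
            + α ^ 2 * ‖g - v‖ ^ 2 * (ρ / (2 * (ρ / (8 * l))) + 1))
          + c ^ 2 * (α * ‖g - v‖ * (35 / 32 * ρ)) ^ 2 := by
        gcongr; exact stepError_clip_le hα (by positivity) hv hw
    _ = 1 + c * α * inner ℝ (g - v) w
          + (16 * l ^ 2 + 4 * l + 1225 / 64 * l ^ 2) / ρ ^ 2 * α ^ 2 * ‖g - v‖ ^ 2 := by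
        rw [hc]; field_simp; ring
    _ ≤ _ := by gcongr; nlinarith

end ClippedStep

section Moments

variable {Ω : Type*} [MeasurableSpace Ω] {μ : Measure Ω}

lemma integral_norm_sum_sq_of_pairwise_indepFun {H ι : Type*} [NormedAddCommGroup H]
    [InnerProductSpace ℝ H] [CompleteSpace H] [MeasurableSpace H] [BorelSpace H]
    [IsFiniteMeasure μ] {Y : ι → Ω → H} {s : Finset ι} (hY : ∀ i ∈ s, MemLp (Y i) 2 μ)
    (h0 : ∀ i ∈ s, ∫ ω, Y i ω ∂μ = 0)
    (hind : Set.Pairwise ↑s fun i j => IndepFun (Y i) (Y j) μ) :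
    ∫ ω, ‖∑ i ∈ s, Y i ω‖ ^ 2 ∂μ = ∑ i ∈ s, ∫ ω, ‖Y i ω‖ ^ 2 ∂μ := by
  classical
  have hint (i) (hi : i ∈ s) : Integrable (Y i) μ := (hY i hi).integrable one_le_two
  have hcross (i) (hi : i ∈ s) (j) (hj : j ∈ s) :
      Integrable (fun ω => inner ℝ (Y i ω) (Y j ω)) μ := by
    rcases eq_or_ne i j with rfl | hij
    · simpa only [real_inner_self_eq_norm_sq] using (hY i hi).integrable_norm_pow two_ne_zero
    · exact (hind hi hj hij).integrable_bilin (hint i hi) (hint j hj) (innerSL ℝ)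
  have hcross0 (i) (hi : i ∈ s) (j) (hj : j ∈ s) (hij : i ≠ j) :
      ∫ ω, inner ℝ (Y i ω) (Y j ω) ∂μ = 0 := by
    have := (hind hi hj hij).integral_bilin (hint i hi) (hint j hj) (innerSL ℝ)
    rwa [h0 i hi, map_zero] at this
  simp_rw [← real_inner_self_eq_norm_sq, sum_inner, inner_sum]
  rw [integral_finsetSum _ fun i hi => integrable_finsetSum _ (hcross i hi)]
  refine Finset.sum_congr rfl fun i hi => ?_
  rw [integral_finsetSum _ (hcross i hi),
    Finset.sum_eq_single_of_mem i hi fun j hj hji => hcross0 i hi j hj hji.symm]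

lemma miniBatch_sub {Ξ : Type*} {n : ℕ} (G : E n → Ξ → E n) (x v : E n) {m : ℕ} (hm : 0 < m)
    (s : ℕ → Ξ) :
    miniBatch G x m s - v = (m : ℝ)⁻¹ • ∑ i ∈ Finset.range m, (G x (s i) - v) := by
  rw [miniBatch, Finset.sum_sub_distrib, smul_sub, Finset.sum_const, Finset.card_range,
    ← Nat.cast_smul_eq_nsmul ℝ, inv_smul_smul₀ (by positivity)]

variable {Ξ : Type*} [MeasurableSpace Ξ] {D : Measure Ξ} {n : ℕ} {f : E n → ℝ}
  {G : E n → Ξ → E n} {σ : ℝ}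

namespace IsStochasticGradient

lemma measurable_apply (hG : IsStochasticGradient D f G σ) (x : E n) : Measurable (G x) :=
  hG.measurable.comp measurable_prodMk_left

lemma memLp_two [IsFiniteMeasure D] (hG : IsStochasticGradient D f G σ) (x : E n) :
    MemLp (G x) 2 D := by
  have hsub : MemLp (fun s => G x s - gradient f x) 2 D :=
    (memLp_two_iff_integrable_sq_norm
      ((hG.measurable_apply x).sub_const _).aestronglyMeasurable).2 (hG.sq_integrable x)
  simpa only [Pi.add_def, sub_add_cancel] using hsub.add (memLp_const (gradient f x))

lemma integrable_comp (hG : IsStochasticGradient D f G σ) {ξ : Ω → Ξ}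
    (hξ : MeasurePreserving ξ μ D) (x : E n) : Integrable (fun ω => G x (ξ ω)) μ :=
  hξ.integrable_comp_of_integrable (hG.integrable x)

lemma integral_comp (hG : IsStochasticGradient D f G σ) {ξ : Ω → Ξ}
    (hξ : MeasurePreserving ξ μ D) (x : E n) : ∫ ω, G x (ξ ω) ∂μ = gradient f x := by
  rw [← hG.unbiased x, ← hξ.map_eq,
    integral_map hξ.aemeasurable (hG.measurable_apply x).aestronglyMeasurable]

lemma integral_norm_comp_sub_sq_le (hG : IsStochasticGradient D f G σ) {ξ : Ω → Ξ}
    (hξ : MeasurePreserving ξ μ D) (x : E n) :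
    ∫ ω, ‖G x (ξ ω) - gradient f x‖ ^ 2 ∂μ ≤ σ ^ 2 := by
  have hmeas : Measurable fun s => ‖G x s - gradient f x‖ ^ 2 :=
    ((hG.measurable_apply x).sub_const _).norm.pow_const 2
  refine le_of_eq_of_le ?_ (hG.variance_le x)
  rw [← hξ.map_eq, integral_map hξ.aemeasurable hmeas.aestronglyMeasurable]

variable {ξ : ℕ → Ω → Ξ} {m : ℕ}

lemma memLp_miniBatch [IsFiniteMeasure D] (hG : IsStochasticGradient D f G σ)
    (hξ : ∀ i, MeasurePreserving (ξ i) μ D) (x : E n) (m : ℕ) :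
    MemLp (fun ω => miniBatch G x m fun i => ξ i ω) 2 μ := by
  have hsum : MemLp (fun ω => ∑ i ∈ Finset.range m, G x (ξ i ω)) 2 μ :=
    memLp_finsetSum _ fun i _ => (hG.memLp_two x).comp_measurePreserving (hξ i)
  exact hsum.const_smul (m : ℝ)⁻¹

lemma integral_miniBatch (hG : IsStochasticGradient D f G σ)
    (hξ : ∀ i, MeasurePreserving (ξ i) μ D) (x : E n) (hm : 0 < m) :
    ∫ ω, miniBatch G x m (fun i => ξ i ω) ∂μ = gradient f x := by
  simp only [miniBatch]
  rw [integral_smul, integral_finsetSum _ fun i _ => hG.integrable_comp (hξ i) x,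
    Finset.sum_congr rfl fun i _ => hG.integral_comp (hξ i) x, Finset.sum_const,
    Finset.card_range, ← Nat.cast_smul_eq_nsmul ℝ, inv_smul_smul₀ (by positivity)]

lemma integral_norm_miniBatch_sub_sq_le [IsProbabilityMeasure μ] [IsFiniteMeasure D]
    (hG : IsStochasticGradient D f G σ) (hξ : ∀ i, MeasurePreserving (ξ i) μ D)
    (hind : Pairwise fun i j => IndepFun (ξ i) (ξ j) μ) (x : E n) (hm : 0 < m) :
    ∫ ω, ‖miniBatch G x m (fun i => ξ i ω) - gradient f x‖ ^ 2 ∂μ ≤ σ ^ 2 / m := by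
  have hmeas : Measurable fun s => G x s - gradient f x := (hG.measurable_apply x).sub_const _
  have hmemLp (i : ℕ) : MemLp (fun ω => G x (ξ i ω) - gradient f x) 2 μ :=
    ((hG.memLp_two x).comp_measurePreserving (hξ i)).sub (memLp_const _)
  have hcentred (i : ℕ) : ∫ ω, (G x (ξ i ω) - gradient f x) ∂μ = 0 := by
    rw [integral_sub (hG.integrable_comp (hξ i) x) (integrable_const _), hG.integral_comp (hξ i)]
    simp
  have hsum := integral_norm_sum_sq_of_pairwise_indepFun (s := Finset.range m)
    (fun i _ => hmemLp i) (fun i _ => hcentred i)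
    (fun i _ j _ hij => (hind hij).comp hmeas hmeas)
  simp only [miniBatch_sub G x (gradient f x) hm, norm_smul, mul_pow]
  rw [integral_const_mul, hsum, norm_inv, Real.norm_natCast]
  calc ((m : ℝ)⁻¹) ^ 2 * ∑ i ∈ Finset.range m, ∫ ω, ‖G x (ξ i ω) - gradient f x‖ ^ 2 ∂μ
      ≤ ((m : ℝ)⁻¹) ^ 2 * ∑ i ∈ Finset.range m, σ ^ 2 := by
        gcongr with i; exact hG.integral_norm_comp_sub_sq_le (hξ i) x
    _ = σ ^ 2 / m := by
        rw [Finset.sum_const, Finset.card_range, nsmul_eq_mul]; field_simp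

end IsStochasticGradient

variable {X : Ω → E n} {v w : E n} {τ α ρ l N : ℝ}

lemma integral_one_add_inner_add_sq [IsProbabilityMeasure μ] (hX : MemLp X 2 μ)
    (hXv : ∫ ω, X ω ∂μ = v) (w : E n) (c Q : ℝ) :
    Integrable (fun ω => 1 + c * inner ℝ (X ω - v) w + Q * ‖X ω - v‖ ^ 2) μ ∧
      ∫ ω, (1 + c * inner ℝ (X ω - v) w + Q * ‖X ω - v‖ ^ 2) ∂μ
        = 1 + Q * ∫ ω, ‖X ω - v‖ ^ 2 ∂μ := by
  have hXint : Integrable X μ := hX.integrable one_le_two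
  have hsub : Integrable (fun ω => X ω - v) μ := hXint.sub (integrable_const v)
  have hinner : Integrable (fun ω => c * inner ℝ (X ω - v) w) μ :=
    (hsub.inner_const w).const_mul c
  have hlin : Integrable (fun ω => 1 + c * inner ℝ (X ω - v) w) μ :=
    (integrable_const _).add hinner
  have hsq : Integrable (fun ω => Q * ‖X ω - v‖ ^ 2) μ :=
    ((hX.sub (memLp_const v)).integrable_norm_pow two_ne_zero).const_mul Q
  have hmean : ∫ ω, inner ℝ (X ω - v) w ∂μ = 0 := by
    simp_rw [real_inner_comm w]
    rw [integral_inner hsub, integral_sub hXint (integrable_const v), hXv]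
    simp
  refine ⟨hlin.add hsq, ?_⟩
  rw [integral_add hlin hsq, integral_add (integrable_const _) hinner, integral_const_mul,
    integral_const_mul, hmean]
  simp

lemma lintegral_exp_stepError_clip_le [IsProbabilityMeasure μ] (hX : MemLp X 2 μ)
    (hXv : ∫ ω, X ω ∂μ = v) (hτ : ∫ ω, ‖X ω - v‖ ^ 2 ∂μ ≤ τ) (hα : 0 < α) (hρ : 0 < ρ)
    (hl : 2 ≤ l) (hN : 0 < N) (hv : ‖v‖ ≤ ρ / (8 * l) / α / 2) (hw : ‖w‖ ≤ ρ)
    (hατ : α ^ 2 * τ ≤ ρ ^ 2 / (6000 * N * l)) :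
    ∫⁻ ω, ENNReal.ofReal (Real.exp (4 * l / ρ ^ 2 *
        stepError α (clip (X ω) (ρ / (8 * l) / α) - v) w)) ∂μ
      ≤ ENNReal.ofReal (Real.exp (l / (100 * N))) := by
  have hpointwise := fun ω => exp_stepError_clip_le (g := X ω) hα hρ hl hv hw
  obtain ⟨hint, hintegral⟩ := integral_one_add_inner_add_sq hX hXv w (4 * l / ρ ^ 2 * α)
    (38 * l ^ 2 / ρ ^ 2 * α ^ 2)
  have hvar : 38 * l ^ 2 / ρ ^ 2 * α ^ 2 * ∫ ω, ‖X ω - v‖ ^ 2 ∂μ ≤ l / (100 * N) :=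
    calc _ ≤ 38 * l ^ 2 / ρ ^ 2 * (α ^ 2 * τ) := by rw [mul_assoc]; gcongr
      _ ≤ 38 * l ^ 2 / ρ ^ 2 * (ρ ^ 2 / (6000 * N * l)) := by gcongr
      _ = 38 / 60 * (l / (100 * N)) := by field_simp; norm_num
      _ ≤ l / (100 * N) := mul_le_of_le_one_left (by positivity) (by norm_num)
  calc _ ≤ ∫⁻ ω, ENNReal.ofReal (1 + 4 * l / ρ ^ 2 * α * inner ℝ (X ω - v) w
          + 38 * l ^ 2 / ρ ^ 2 * α ^ 2 * ‖X ω - v‖ ^ 2) ∂μ :=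
        lintegral_mono fun ω => ENNReal.ofReal_le_ofReal (hpointwise ω)
    _ = ENNReal.ofReal (1 + 38 * l ^ 2 / ρ ^ 2 * α ^ 2 * ∫ ω, ‖X ω - v‖ ^ 2 ∂μ) := by
        rw [← hintegral, ofReal_integral_eq_lintegral_ofReal hint
          (.of_forall fun ω => (Real.exp_pos _).le.trans (hpointwise ω))]
    _ ≤ _ := by
        refine ENNReal.ofReal_le_ofReal ?_
        linarith [Real.add_one_le_exp (l / (100 * N))]

end Moments

section Measurability

variable {n : ℕ} {Ξ : Type u} [MeasurableSpace Ξ] {f : E n → ℝ} {G : E n → Ξ → E n}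
  {a L B b ρ : ℝ} {m : ℕ → ℕ} {x0 xs : E n}

lemma measurable_gradient (f : E n → ℝ) : Measurable (gradient f) :=
  (InnerProductSpace.toDual ℝ (E n)).symm.continuous.measurable.comp (measurable_fderiv ℝ f)

@[fun_prop]
lemma measurable_clip (lam : ℝ) : Measurable fun g : E n => clip g lam := by
  unfold clip
  fun_prop

@[fun_prop]
lemma measurable_extrapolation (a L : ℝ) (k : ℕ) :
    Measurable (extrapolation (n := n) a L k) := by
  unfold extrapolation weightedMean
  fun_prop

lemma measurable_miniBatch (hG : Measurable (Function.uncurry G)) (m : ℕ) :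
    Measurable fun q : E n × (ℕ → Ξ) => miniBatch G q.1 m q.2 := by
  have (i : ℕ) : Measurable fun q : E n × (ℕ → Ξ) => G q.1 (q.2 i) :=
    hG.comp (f := fun q : E n × (ℕ → Ξ) => (q.1, q.2 i)) (by fun_prop)
  unfold miniBatch
  fun_prop

lemma measurable_clip_miniBatch (hG : Measurable (Function.uncurry G)) (k : ℕ) :
    Measurable fun q : (E n × E n) × (ℕ → Ξ) =>
      clip (miniBatch G (extrapolation a L k q.1) (m k) q.2) (B / alpha a L (k + 1)) := by
  have := (measurable_miniBatch hG (m k)).comp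
    (f := fun q : (E n × E n) × (ℕ → Ξ) => (extrapolation a L k q.1, q.2)) (by fun_prop)
  exact (measurable_clip _).comp this

lemma measurable_noise (hG : Measurable (Function.uncurry G)) (k : ℕ) :
    Measurable fun q : (E n × E n) × (ℕ → Ξ) => noise f G a L B m xs k q.1 q.2 := by
  have hclip := measurable_clip_miniBatch (a := a) (L := L) (B := B) (m := m) hG k
  have hgrad := measurable_gradient f
  unfold noise stepError
  fun_prop

lemma measurableSet_inRegion (hf : Measurable f) (k : ℕ) :
    MeasurableSet {p | InRegion f a L ρ xs k p} := by
  unfold InRegion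
  measurability

lemma measurable_gatedNoise (hf : Measurable f) (hG : Measurable (Function.uncurry G)) (k : ℕ) :
    Measurable fun q : ((E n × E n) × ℝ) × (ℕ → Ξ) =>
      gatedNoise f G a L B m xs ρ b k q.1 q.2 := by
  have hle : MeasurableSet {q : ((E n × E n) × ℝ) × (ℕ → Ξ) | q.1.2 ≤ b} :=
    measurableSet_le (by fun_prop) measurable_const
  have hregion : MeasurableSet {q : ((E n × E n) × ℝ) × (ℕ → Ξ) | InRegion f a L ρ xs k q.1.1} :=
    measurable_fst.fst (measurableSet_inRegion hf k)
  have hnoise := (measurable_noise (f := f) (a := a) (L := L) (B := B) (m := m) (xs := xs) hG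
    k).comp (f := fun q : ((E n × E n) × ℝ) × (ℕ → Ξ) => (q.1.1, q.2)) (by fun_prop)
  unfold gatedNoise
  exact Measurable.ite (hle.inter hregion) hnoise measurable_const

lemma measurable_iterates_stoppedNoise {Ω : Type*} [MeasurableSpace Ω] (hf : Measurable f)
    (hG : Measurable (Function.uncurry G)) {s : Ω → ℕ → ℕ → Ξ} (k : ℕ)
    (hs : ∀ j < k, Measurable fun ω => s ω j) :
    Measurable fun ω =>
      (iterates G a L B m x0 (s ω) k, stoppedNoise f G a L B m x0 xs ρ b (s ω) k) := by
  induction k with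
  | zero => simp only [iterates, stoppedNoise, measurable_const]
  | succ k ih =>
    have hprev := ih fun j hj => hs j (hj.trans k.lt_succ_self)
    have hk := hs k k.lt_succ_self
    have hp := hprev.fst
    have hclip := (measurable_clip_miniBatch (a := a) (L := L) (B := B) (m := m) hG k).comp
      (hp.prodMk hk)
    have hgated := (measurable_gatedNoise (a := a) (L := L) (B := B) (m := m) (xs := xs)
      (ρ := ρ) (b := b) hf hG k).comp (hprev.prodMk hk)
    have hz := hp.snd.sub (hclip.const_smul (alpha a L (k + 1)))
    simp only [iterates_succ, stoppedNoise]
    exact (((measurable_extrapolation a L k).comp (hp.fst.prodMk hz)).prodMk hz).prodMk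
      (hprev.snd.add hgated)

lemma measurable_stoppedNoise {Ω : Type*} [MeasurableSpace Ω] (hf : Measurable f)
    (hG : Measurable (Function.uncurry G)) {ξ : ℕ → ℕ → Ω → Ξ} (hξ : ∀ k i, Measurable (ξ k i))
    (k : ℕ) :
    Measurable fun ω => stoppedNoise f G a L B m x0 xs ρ b (fun k i => ξ k i ω) k :=
  (measurable_iterates_stoppedNoise hf hG k fun j _ => measurable_pi_lambda _ (hξ j)).snd

end Measurability

section Independence

lemma measurable_row_iSup_comap {Ω Ξ : Type*} [MeasurableSpace Ξ] {ξ : ℕ → ℕ → Ω → Ξ}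
    {J : Set (ℕ × ℕ)} {j : ℕ} (hj : ∀ i, (j, i) ∈ J) :
    Measurable[⨆ p ∈ J, MeasurableSpace.comap (ξ p.1 p.2) inferInstance]
      fun ω i => ξ j i ω := by
  refine @measurable_pi_lambda _ _ _ (_) _ _ fun i => ?_
  exact (comap_measurable (ξ j i)).mono (le_iSup₂_of_le (j, i) (hj i) le_rfl) le_rfl

variable {Ω : Type v} [MeasurableSpace Ω] {μ : Measure Ω}

lemma lintegral_mul_le_of_indepFun [IsFiniteMeasure μ] {S T : Type*} [MeasurableSpace S]
    [MeasurableSpace T] {X : Ω → S} {Y : Ω → T} (hX : Measurable X) (hY : Measurable Y)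
    (hXY : IndepFun X Y μ) {u : S → ENNReal} (hu : Measurable u) {h : S → T → ENNReal}
    (hh : Measurable (Function.uncurry h)) {c : ENNReal} (hc : ∀ x, ∫⁻ ω, h x (Y ω) ∂μ ≤ c) :
    ∫⁻ ω, u (X ω) * h (X ω) (Y ω) ∂μ ≤ (∫⁻ ω, u (X ω) ∂μ) * c := by
  have huh : Measurable fun q : S × T => u q.1 * h q.1 q.2 := (hu.comp measurable_fst).mul hh
  have hinner (x : S) : ∫⁻ y, u x * h x y ∂(μ.map Y) ≤ u x * c := by
    have hx : Measurable (h x) := hh.comp measurable_prodMk_left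
    rw [lintegral_const_mul _ hx, lintegral_map hx hY]
    gcongr
    exact hc x
  calc ∫⁻ ω, u (X ω) * h (X ω) (Y ω) ∂μ
      = ∫⁻ q, u q.1 * h q.1 q.2 ∂(μ.map fun ω => (X ω, Y ω)) :=
        (lintegral_map huh (hX.prodMk hY)).symm
    _ = ∫⁻ x, ∫⁻ y, u x * h x y ∂(μ.map Y) ∂(μ.map X) := by
        rw [hXY.map_prod_eq_prod_map_map hX.aemeasurable hY.aemeasurable,
          lintegral_prod _ huh.aemeasurable]
    _ ≤ ∫⁻ x, u x * c ∂(μ.map X) := lintegral_mono hinner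
    _ = (∫⁻ ω, u (X ω) ∂μ) * c := by rw [lintegral_mul_const _ hu, lintegral_map hu hX]

variable {Ξ : Type u} [MeasurableSpace Ξ] {ξ : ℕ → ℕ → Ω → Ξ}

-- The hypothesis on `X` says that `X` is a measurable function of the first `k` rows.
lemma indepFun_row {S : Type*} [MeasurableSpace S] (hξ : ∀ k i, Measurable (ξ k i))
    (hind : iIndepFun (fun p : ℕ × ℕ => ξ p.1 p.2) μ) (k : ℕ) {X : Ω → S}
    (hX : ∀ 𝓜 : MeasurableSpace Ω,
      (∀ j < k, Measurable[𝓜] fun ω i => ξ j i ω) → Measurable[𝓜] X) :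
    IndepFun X (fun ω i => ξ k i ω) μ := by
  have hdisj : Disjoint {p : ℕ × ℕ | p.1 < k} {p : ℕ × ℕ | p.1 = k} :=
    Set.disjoint_left.2 fun p hlt heq => hlt.ne heq
  have hrows := indep_iSup_of_disjoint (fun p => (hξ p.1 p.2).comap_le) hind.iIndep hdisj
  rw [IndepFun_iff_Indep]
  refine indep_of_indep_of_le_left (indep_of_indep_of_le_right hrows ?_) ?_
  · exact (measurable_row_iSup_comap fun _ => rfl).comap_le
  · exact (hX _ fun j hj => measurable_row_iSup_comap fun _ => hj).comap_le

end Independence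

section Concentration

lemma measureReal_ge_le_of_lintegral_exp_le {Ω : Type*} [MeasurableSpace Ω] {μ : Measure Ω}
    [IsFiniteMeasure μ] {X : Ω → ℝ} (hX : Measurable X) {t c : ℝ} (ht : 0 ≤ t)
    (h : ∫⁻ ω, ENNReal.ofReal (Real.exp (t * X ω)) ∂μ ≤ ENNReal.ofReal (Real.exp c)) (b : ℝ) :
    μ.real {ω | b ≤ X ω} ≤ Real.exp (c - t * b) := by
  have hmeas : AEStronglyMeasurable (fun ω => Real.exp (t * X ω)) μ :=
    (hX.const_mul t).exp.aestronglyMeasurable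
  have hnonneg : 0 ≤ᵐ[μ] fun ω => Real.exp (t * X ω) := .of_forall fun _ => (Real.exp_pos _).le
  have hint : Integrable (fun ω => Real.exp (t * X ω)) μ :=
    (lintegral_ofReal_ne_top_iff_integrable hmeas hnonneg).1 (h.trans_lt ENNReal.ofReal_lt_top).ne
  have hmgf : mgf X μ t ≤ Real.exp c := by
    rwa [← ofReal_integral_eq_lintegral_ofReal hint hnonneg,
      ENNReal.ofReal_le_ofReal_iff (Real.exp_pos _).le] at h
  calc μ.real {ω | b ≤ X ω} ≤ Real.exp (-t * b) * mgf X μ t := measure_ge_le_exp_mul_mgf b ht hint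
    _ ≤ Real.exp (-t * b) * Real.exp c := by gcongr
    _ = Real.exp (c - t * b) := by rw [← Real.exp_add]; ring_nf

variable {n : ℕ} {Ξ : Type u} [MeasurableSpace Ξ] {D : Measure Ξ} [IsFiniteMeasure D]
  {Ω : Type v} [MeasurableSpace Ω] {μ : Measure Ω} [IsProbabilityMeasure μ] {f : E n → ℝ}
  {G : E n → Ξ → E n} {ξ : ℕ → ℕ → Ω → Ξ} {a L l ρ σ : ℝ} {m : ℕ → ℕ} {x0 xs : E n} {N : ℕ}

lemma lintegral_exp_gatedNoise_le (hf : IsSmooth L f) (hxs : ∀ x, f xs ≤ f x) (hL : 0 < L)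
    (hl : 2 ≤ l) (hρ : 0 < ρ) (ha : 36 * stepRoot l ^ 2 ≤ a)
    (hG : IsStochasticGradient D f G σ) {ξ : ℕ → Ω → Ξ} (hξ : ∀ i, MeasurePreserving (ξ i) μ D)
    (hind : Pairwise fun i j => IndepFun (ξ i) (ξ j) μ) (hN : 0 < N) {k : ℕ} (hm0 : 0 < m k)
    (hm : alpha a L (k + 1) ^ 2 * (σ ^ 2 / m k) ≤ ρ ^ 2 / (6000 * N * l)) (b : ℝ)
    (q : (E n × E n) × ℝ) :
    ∫⁻ ω, ENNReal.ofReal (Real.exp (4 * l / ρ ^ 2 *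
        gatedNoise f G a L (ρ / (8 * l)) m xs ρ b k q (fun i => ξ i ω))) ∂μ
      ≤ ENNReal.ofReal (Real.exp (l / (100 * N))) := by
  by_cases hq : q.2 ≤ b ∧ InRegion f a L ρ xs k q.1
  · simp only [gatedNoise, if_pos hq, noise]
    have hu : 4 * l ≤ stepRoot l := four_mul_le_stepRoot (by linarith)
    have ha0 : 0 < a := by nlinarith
    exact lintegral_exp_stepError_clip_le (hG.memLp_miniBatch hξ _ _)
      (hG.integral_miniBatch hξ _ hm0) (hG.integral_norm_miniBatch_sub_sq_le hξ hind _ hm0)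
      (alpha_succ_pos ha0 hL k) hρ hl (by positivity)
      (norm_gradient_extrapolation_le hf hxs hL (by linarith) ha hq.2)
      ((norm_sub_rev _ _).trans_le hq.2.2.1) hm
  · simp only [gatedNoise, if_neg hq, mul_zero, Real.exp_zero, lintegral_const, measure_univ,
      mul_one]
    exact ENNReal.ofReal_le_ofReal (Real.one_le_exp (by positivity))

lemma lintegral_exp_stoppedNoise_le (hf : IsSmooth L f) (hxs : ∀ x, f xs ≤ f x) (hL : 0 < L)
    (hl : 2 ≤ l) (hρ : 0 < ρ) (ha : 36 * stepRoot l ^ 2 ≤ a)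
    (hG : IsStochasticGradient D f G σ) (hξ : ∀ k i, MeasurePreserving (ξ k i) μ D)
    (hind : iIndepFun (fun p : ℕ × ℕ => ξ p.1 p.2) μ) (hN : 0 < N) (hm0 : ∀ k, 0 < m k)
    (hm : ∀ k, alpha a L (k + 1) ^ 2 * (σ ^ 2 / m k) ≤ ρ ^ 2 / (6000 * N * l)) (b : ℝ) (k : ℕ) :
    ∫⁻ ω, ENNReal.ofReal (Real.exp (4 * l / ρ ^ 2 *
        stoppedNoise f G a L (ρ / (8 * l)) m x0 xs ρ b (fun k i => ξ k i ω) k)) ∂μ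
      ≤ ENNReal.ofReal (Real.exp (k * (l / (100 * N)))) := by
  induction k with
  | zero => simp [stoppedNoise]
  | succ k ih =>
    have hfm : Measurable f := hf.1.continuous.measurable
    have hmeas (k i : ℕ) : Measurable (ξ k i) := (hξ k i).measurable
    have hrow (j : ℕ) : Measurable fun ω i => ξ j i ω := measurable_pi_lambda _ (hmeas j)
    have hindk : Pairwise fun i j => IndepFun (ξ k i) (ξ k j) μ := fun i j hij =>
      hind.indepFun (i := (k, i)) (j := (k, j)) (by simpa using hij)
    have hstate := measurable_iterates_stoppedNoise (a := a) (L := L) (B := ρ / (8 * l)) (m := m)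
      (x0 := x0) (xs := xs) (ρ := ρ) (b := b) (s := fun ω k i => ξ k i ω) hfm hG.measurable k
      fun j _ => hrow j
    have hindep := indepFun_row hmeas hind k fun 𝓜 h𝓜 =>
      @measurable_iterates_stoppedNoise n Ξ _ f G a L (ρ / (8 * l)) b ρ m x0 xs Ω 𝓜 hfm
        hG.measurable (fun ω k i => ξ k i ω) k h𝓜
    have hgated : Measurable (Function.uncurry fun q s => ENNReal.ofReal (Real.exp (4 * l / ρ ^ 2 *
        gatedNoise f G a L (ρ / (8 * l)) m xs ρ b k q s))) :=
      ((measurable_gatedNoise hfm hG.measurable k).const_mul _).exp.ennreal_ofReal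
    calc _ = _ := lintegral_congr fun ω => by
          rw [stoppedNoise, mul_add, Real.exp_add, ENNReal.ofReal_mul (Real.exp_pos _).le]
      _ ≤ _ := lintegral_mul_le_of_indepFun hstate (hrow k) hindep
          (u := fun q => ENNReal.ofReal (Real.exp (4 * l / ρ ^ 2 * q.2))) (by fun_prop) hgated
          (lintegral_exp_gatedNoise_le hf hxs hL hl hρ ha hG (hξ k) hindk hN (hm0 k) (hm k) b)
      _ ≤ ENNReal.ofReal (Real.exp (k * (l / (100 * N)))) *
          ENNReal.ofReal (Real.exp (l / (100 * N))) := by gcongr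
      _ = _ := by
          rw [← ENNReal.ofReal_mul (Real.exp_pos _).le, ← Real.exp_add, ← add_one_mul,
            Nat.cast_succ]

lemma measureReal_le_stoppedNoise_le (hf : IsSmooth L f) (hxs : ∀ x, f xs ≤ f x) (hL : 0 < L)
    (hl : 2 ≤ l) (hρ : 0 < ρ) (ha : 36 * stepRoot l ^ 2 ≤ a)
    (hG : IsStochasticGradient D f G σ) (hξ : ∀ k i, MeasurePreserving (ξ k i) μ D)
    (hind : iIndepFun (fun p : ℕ × ℕ => ξ p.1 p.2) μ) (hN : 0 < N) (hm0 : ∀ k, 0 < m k)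
    (hm : ∀ k, alpha a L (k + 1) ^ 2 * (σ ^ 2 / m k) ≤ ρ ^ 2 / (6000 * N * l)) :
    μ.real {ω | 2 / 5 * ρ ^ 2 ≤ stoppedNoise f G a L (ρ / (8 * l)) m x0 xs ρ (2 / 5 * ρ ^ 2)
      (fun k i => ξ k i ω) N} ≤ Real.exp (-l) := by
  have hT := measurable_stoppedNoise (a := a) (L := L) (B := ρ / (8 * l)) (m := m) (x0 := x0)
    (xs := xs) (ρ := ρ) (b := 2 / 5 * ρ ^ 2) hf.1.continuous.measurable hG.measurable
    (fun k i => (hξ k i).measurable) N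
  calc _ ≤ Real.exp (N * (l / (100 * N)) - 4 * l / ρ ^ 2 * (2 / 5 * ρ ^ 2)) :=
        measureReal_ge_le_of_lintegral_exp_le hT (by positivity)
          (lintegral_exp_stoppedNoise_le hf hxs hL hl hρ ha hG hξ hind hN hm0 hm _ N) _
    _ = Real.exp (-(159 / 100) * l) := by congr 1; field_simp; ring
    _ ≤ Real.exp (-l) := Real.exp_le_exp.2 (by linarith)

lemma one_sub_exp_le_measureReal_bigA_mul_le (hf : IsSmooth L f) (hc : ConvexOn ℝ Set.univ f)
    (hxs : ∀ x, f xs ≤ f x) (hL : 0 < L) (hl : 2 ≤ l) (hρ : 0 < ρ)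
    (hx : 5 * ‖x0 - xs‖ ^ 2 ≤ ρ ^ 2) (ha : 36 * stepRoot l ^ 2 ≤ a)
    (hG : IsStochasticGradient D f G σ) (hξ : ∀ k i, MeasurePreserving (ξ k i) μ D)
    (hind : iIndepFun (fun p : ℕ × ℕ => ξ p.1 p.2) μ) (hN : 0 < N) (hm0 : ∀ k, 0 < m k)
    (hm : ∀ k, alpha a L (k + 1) ^ 2 * (σ ^ 2 / m k) ≤ ρ ^ 2 / (6000 * N * l)) :
    1 - Real.exp (-l) ≤ μ.real {ω | bigA a L N *
      (f (output G a L (ρ / (8 * l)) m x0 (fun k i => ξ k i ω) N) - f xs) ≤ ρ ^ 2 / 2} := by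
  set T : Ω → ℝ := fun ω => stoppedNoise f G a L (ρ / (8 * l)) m x0 xs ρ (2 / 5 * ρ ^ 2)
    (fun k i => ξ k i ω) N
  have hT : Measurable T := measurable_stoppedNoise hf.1.continuous.measurable hG.measurable
    (fun k i => (hξ k i).measurable) N
  have ha2 : 2 ≤ a := by
    have := four_mul_le_stepRoot (l := l) (by linarith)
    nlinarith
  calc 1 - Real.exp (-l) ≤ 1 - μ.real {ω | 2 / 5 * ρ ^ 2 ≤ T ω} :=
        sub_le_sub_left
          (measureReal_le_stoppedNoise_le hf hxs hL hl hρ ha hG hξ hind hN hm0 hm) 1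
    _ = μ.real {ω | 2 / 5 * ρ ^ 2 ≤ T ω}ᶜ :=
        (probReal_compl_eq_one_sub (measurableSet_le measurable_const hT)).symm
    _ ≤ _ := measureReal_mono fun ω (hω : ¬2 / 5 * ρ ^ 2 ≤ T ω) =>
        output_sub_le hf hc hxs ha2 hL (by positivity) hρ.le (by linarith) _ N (le_of_not_ge hω)

end Concentration

section Parameters

variable {L σ R β ε : ℝ} {N k : ℕ}

lemma constC_sq : constC ^ 2 = 5 := Real.sq_sqrt (by norm_num)

lemma mul_stepRoot_sq_le_stepParam (L σ R β : ℝ) (N : ℕ) :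
    36 * stepRoot (logFactor N β) ^ 2 ≤ stepParam L σ R β N :=
  ((le_max_right _ _).trans (le_max_right _ _)).trans (le_max_left _ _)

lemma stepParam_pos (L σ R β : ℝ) (N : ℕ) : 0 < stepParam L σ R β N :=
  one_pos.trans_le ((le_max_left _ _).trans (le_max_left _ _))

lemma stepParam'_le (hl : 2 ≤ logFactor N β) : stepParam' β N ≤ 651 * logFactor N β ^ 2 := by
  unfold stepParam'
  set l := logFactor N β
  have hC : 1 ≤ constC := Real.one_le_sqrt.2 (by norm_num)
  have hsqrt : √(4 * l ^ 2 + 2 * l) ≤ 9 / 4 * l := Real.sqrt_le_iff.2 ⟨by positivity, by nlinarith⟩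
  refine max_le (by nlinarith) (max_le ?_ ?_)
  · exact (div_le_self (by positivity) hC).trans (by nlinarith)
  · calc _ ≤ 36 * (2 * l + 9 / 4 * l) ^ 2 := by gcongr
      _ ≤ _ := by nlinarith [sq_nonneg l]

lemma rpow_three_halves {x : ℝ} (hx : 0 ≤ x) : x ^ (3 / 2 : ℝ) = x * √x := by
  rw [show (3 / 2 : ℝ) = 1 + 1 / 2 by norm_num, Real.rpow_one_add' hx (by norm_num),
    Real.sqrt_eq_rpow]

lemma batchSize_pos (L σ R β : ℝ) (N k : ℕ) : 0 < batchSize L σ R β N k :=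
  Nat.ceil_pos.2 (one_pos.trans_le (le_max_left _ _))

lemma le_batchSize (L σ R β : ℝ) (N k : ℕ) :
    6000 * σ ^ 2 * alpha (stepParam L σ R β N) L (k + 1) ^ 2 * N * logFactor N β
      / (constC ^ 2 * R ^ 2) ≤ batchSize L σ R β N k :=
  ((le_max_left _ _).trans (le_max_right _ _)).trans (Nat.le_ceil _)

lemma alpha_sq_mul_variance_le (hR : 0 < R) (hN : 0 < N) (hl : 0 < logFactor N β) (k : ℕ) :
    alpha (stepParam L σ R β N) L (k + 1) ^ 2 * (σ ^ 2 / batchSize L σ R β N k)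
      ≤ (constC * R) ^ 2 / (6000 * N * logFactor N β) := by
  have hb : (0 : ℝ) < batchSize L σ R β N k := Nat.cast_pos.2 (batchSize_pos L σ R β N k)
  have hle := le_batchSize L σ R β N k
  rw [← mul_pow, div_le_iff₀ (by rw [mul_pow, constC_sq]; positivity)] at hle
  rw [mul_div_assoc', div_le_div_iff₀ hb (by positivity)]
  linarith

lemma alpha_mul_sqrt_mul_sqrt_le (hL : 0 < L) (hσ : 0 ≤ σ) (hR : 0 < R) (hN : 1 ≤ N)
    (hk : k ≤ N) :
    σ * alpha (stepParam L σ R β N) L (k + 1) * √N * √(logFactor N β) ≤ 3 / 2 * R := by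
  have hk' : (k : ℝ) + 2 ≤ 3 * N := by norm_cast; omega
  have ha0 := stepParam_pos L σ R β N
  have ha : σ * (N : ℝ) ^ (3 / 2 : ℝ) / (L * R) * √(logFactor N β) ≤ stepParam L σ R β N :=
    le_max_right _ _
  rw [rpow_three_halves N.cast_nonneg, div_mul_eq_mul_div, div_le_iff₀ (by positivity)] at ha
  rw [alpha]
  set a := stepParam L σ R β N
  calc _ = (σ * (k + 2) * √N * √(logFactor N β)) / (2 * a * L) := by field_simp
    _ ≤ (σ * (3 * N) * √N * √(logFactor N β)) / (2 * a * L) := by gcongr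
    _ = 3 * (σ * (N * √N) * √(logFactor N β)) / (2 * a * L) := by ring
    _ ≤ 3 * (a * (L * R)) / (2 * a * L) := by gcongr
    _ = 3 / 2 * R := by field_simp

lemma batchSize_le (hL : 0 < L) (hσ : 0 ≤ σ) (hR : 0 < R) (hN : 1 ≤ N)
    (hl : 2 ≤ logFactor N β) (hk : k ≤ N) : (batchSize L σ R β N k : ℝ) ≤ 2701 := by
  have hα0 := (alpha_succ_pos (stepParam_pos L σ R β N) hL k).le
  have hα := alpha_mul_sqrt_mul_sqrt_le (β := β) hL hσ hR hN hk
  rw [batchSize]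
  set α := alpha (stepParam L σ R β N) L (k + 1)
  have hsq : σ ^ 2 * α ^ 2 * N * logFactor N β ≤ 9 / 4 * R ^ 2 := by
    have := pow_le_pow_left₀ (by positivity) hα 2
    rw [mul_pow, mul_pow, mul_pow, Real.sq_sqrt N.cast_nonneg, Real.sq_sqrt (by linarith)] at this
    linarith
  have hfst : 6000 * σ ^ 2 * α ^ 2 * N * logFactor N β / (constC ^ 2 * R ^ 2) ≤ 2700 := by
    rw [constC_sq, div_le_iff₀ (by positivity)]
    linarith
  have hsnd : 10368 * σ ^ 2 * α ^ 2 * N / (constC ^ 2 * R ^ 2) ≤ 2700 := by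
    have := mul_le_mul_of_nonneg_left hl (by positivity : 0 ≤ σ ^ 2 * α ^ 2 * N)
    rw [constC_sq, div_le_iff₀ (by positivity)]
    linarith [sq_nonneg R]
  have hmax := max_le (by norm_num : (1 : ℝ) ≤ 2700) (max_le hfst hsnd)
  exact (Nat.ceil_lt_add_one (zero_le_one.trans (le_max_left _ _))).le.trans (by linarith)

lemma sum_batchSize_le (hL : 0 < L) (hσ : 0 ≤ σ) (hR : 0 < R) (hN : 1 ≤ N)
    (hl : 2 ≤ logFactor N β) :
    ((∑ k ∈ Finset.range N, batchSize L σ R β N k : ℕ) : ℝ) ≤ 2701 * N := by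
  rw [Nat.cast_sum, mul_comm]
  simpa using Finset.sum_le_card_nsmul (Finset.range N) _ 2701 fun k hk =>
    batchSize_le hL hσ hR hN hl (Finset.mem_range.1 hk).le

end Parameters

section Complexity

variable {L σ R β ε : ℝ} {N : ℕ}

lemma mul_stepParam'_mul_le (hL : 0 ≤ L) (hε : 0 ≤ ε) (hl : 2 ≤ logFactor N β)
    (h : 100 * √(L * R ^ 2 / ε) * logFactor N β ≤ N) :
    10 * stepParam' β N * (L * R ^ 2 / ε) ≤ (N : ℝ) ^ 2 := by
  set q := L * R ^ 2 / ε
  have hq : 0 ≤ q := by positivity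
  calc 10 * stepParam' β N * q ≤ 10 * (651 * logFactor N β ^ 2) * q := by
        gcongr; exact stepParam'_le hl
    _ ≤ 10000 * q * logFactor N β ^ 2 := by nlinarith [mul_nonneg hq (sq_nonneg (logFactor N β))]
    _ = (100 * √q * logFactor N β) ^ 2 := by rw [mul_pow, mul_pow, Real.sq_sqrt hq]; norm_num
    _ ≤ (N : ℝ) ^ 2 := by gcongr

lemma mul_noise_stepParam_mul_le (hL : 0 < L) (hR : 0 < R) (hl : 0 ≤ logFactor N β)
    (h : 100 * (σ * R / ε) ^ 2 * logFactor N β ≤ N) :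
    10 * (σ * (N : ℝ) ^ (3 / 2 : ℝ) / (L * R) * √(logFactor N β)) * (L * R ^ 2 / ε)
      ≤ (N : ℝ) ^ 2 := by
  have hsqrt : 10 * (σ * R / ε) * √(logFactor N β) ≤ √N := by
    refine Real.le_sqrt_of_sq_le ?_
    rw [mul_pow, mul_pow, Real.sq_sqrt hl]
    linarith
  rw [rpow_three_halves N.cast_nonneg]
  calc _ = 10 * (σ * R / ε) * √(logFactor N β) * (N * √N) := by field_simp
    _ ≤ √N * (N * √N) := by gcongr
    _ = √N ^ 2 * N := by ring
    _ = (N : ℝ) ^ 2 := by rw [Real.sq_sqrt N.cast_nonneg]; ring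

lemma mul_stepParam_mul_le (hL : 0 < L) (hR : 0 < R) (hε : 0 < ε) (hl : 2 ≤ logFactor N β)
    (h : 100 * max √(L * R ^ 2 / ε) ((σ * R / ε) ^ 2) * logFactor N β ≤ N) :
    10 * stepParam L σ R β N * (L * R ^ 2 / ε) ≤ (N : ℝ) ^ 2 := by
  rw [stepParam, mul_max_of_nonneg _ _ (by norm_num), max_mul_of_nonneg _ _ (by positivity)]
  refine max_le (mul_stepParam'_mul_le hL.le hε.le hl (le_trans ?_ h))
    (mul_noise_stepParam_mul_le hL hR (by linarith) (le_trans ?_ h))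
  · gcongr; exact le_max_left _ _
  · gcongr; exact le_max_right _ _

lemma le_of_bigA_mul_le {a Δ : ℝ} (ha : 0 < a) (hL : 0 < L) (hε : 0 < ε) (hN : 0 < N)
    (hNa : 10 * a * (L * R ^ 2 / ε) ≤ (N : ℝ) ^ 2) (h : bigA a L N * Δ ≤ 5 / 2 * R ^ 2) :
    Δ ≤ ε := by
  refine le_of_mul_le_mul_left (h.trans ?_) (bigA_pos ha hL hN)
  rw [← mul_div_assoc, div_le_iff₀ hε] at hNa
  rw [bigA_eq, div_mul_eq_mul_div (_ * _), le_div_iff₀ (by positivity)]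
  nlinarith [mul_nonneg (N.cast_nonneg : (0 : ℝ) ≤ N) hε.le]

lemma log_800_le : Real.log 800 ≤ 7 := by
  rw [Real.log_le_iff_le_exp (by norm_num), show (7 : ℝ) = (7 : ℕ) by norm_num,
    ← Real.exp_one_pow]
  calc (800 : ℝ) ≤ 2.7 ^ 7 := by norm_num
    _ ≤ Real.exp 1 ^ 7 := by gcongr; linarith [Real.exp_one_gt_d9]

lemma mul_log_div_le_of_exp_one_le {q s : ℝ} (hq : 0 < q) (hs : 0 ≤ s) (hβ : 0 < β) (hβ1 : β ≤ 1)
    (h : Real.exp 1 ≤ q + s) :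
    max √q (s ^ 2) * (7 + Real.log (max √q (s ^ 2) / (q + s)))
      ≤ 8 * (max √q (s ^ 2) * Real.log ((q + s) / β)) := by
  have ht1 : 1 ≤ q + s := (Real.one_le_exp zero_le_one).trans h
  have hM : max √q (s ^ 2) ≤ (q + s) ^ 2 :=
    max_le (Real.sqrt_le_iff.2 ⟨by positivity, by
      nlinarith [pow_le_pow_right₀ ht1 (show 1 ≤ 4 by norm_num)]⟩) (by gcongr; linarith)
  have hlog1 : 1 ≤ Real.log (q + s) := (Real.le_log_iff_exp_le (by linarith)).2 h
  have hlogβ : Real.log (q + s) ≤ Real.log ((q + s) / β) :=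
    Real.log_le_log (by linarith) (le_div_self (by linarith) hβ hβ1)
  have hlogM : Real.log (max √q (s ^ 2) / (q + s)) ≤ Real.log (q + s) :=
    Real.log_le_log (by positivity) (by rw [div_le_iff₀ (by linarith)]; linarith)
  rw [mul_left_comm]
  gcongr
  linarith

lemma mul_log_div_le_of_le_three {q s : ℝ} (hq : 0 < q) (hs : 0 ≤ s) (h : q + s ≤ 3) :
    max √q (s ^ 2) * (7 + Real.log (max √q (s ^ 2) / (q + s))) ≤ 90 := by
  have hM : max √q (s ^ 2) ≤ 9 :=
    max_le (Real.sqrt_le_iff.2 ⟨by norm_num, by linarith⟩) (by nlinarith)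
  have hMsq : max √q (s ^ 2) * max √q (s ^ 2) ≤ 27 * (q + s) := by
    rcases max_choice √q (s ^ 2) with hmax | hmax <;> rw [hmax]
    · rw [Real.mul_self_sqrt hq.le]
      linarith
    · calc s ^ 2 * s ^ 2 = s ^ 3 * s := by ring
        _ ≤ 3 ^ 3 * (q + s) := by gcongr <;> linarith
        _ = 27 * (q + s) := by norm_num
  have hlog : max √q (s ^ 2) * Real.log (max √q (s ^ 2) / (q + s)) ≤ 27 :=
    calc _ ≤ max √q (s ^ 2) * (max √q (s ^ 2) / (q + s)) := by
          gcongr; exact Real.log_le_self (by positivity)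
      _ ≤ 27 := by rwa [mul_div_assoc', div_le_iff₀ (by positivity)]
  linarith

lemma mul_log_le_of_le {q s x : ℝ} (hq : 0 < q) (hs : 0 ≤ s) (hβ : 0 < β) (hβ1 : β ≤ 1)
    (hx : 20000 * max 1 (max √q (s ^ 2) * Real.log ((q + s) / β)) ≤ x) :
    100 * max √q (s ^ 2) * Real.log (4 * x / β) ≤ x := by
  have hlarge := mul_log_div_le_of_exp_one_le hq hs hβ hβ1
  have hsmall := mul_log_div_le_of_le_three hq hs
  have ht0 : 0 < q + s := by positivity
  have hM0 : 0 < max √q (s ^ 2) := lt_max_of_lt_left (Real.sqrt_pos.2 hq)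
  set M := max √q (s ^ 2)
  set t := q + s
  have hx1 : 20000 ≤ x := by linarith [le_max_left 1 (M * Real.log (t / β))]
  have hxM : 20000 * (M * Real.log (t / β)) ≤ x := by
    linarith [le_max_right 1 (M * Real.log (t / β))]
  have hsplit : Real.log (4 * x / β) = Real.log (x / (200 * M)) + Real.log 800
      + Real.log (M / t) + Real.log (t / β) := by
    rw [← Real.log_mul (by positivity) (by norm_num),
      ← Real.log_mul (by positivity) (by positivity),
      ← Real.log_mul (by positivity) (by positivity)]
    congr 1
    field_simp
    norm_num
  have hself : M * Real.log (x / (200 * M)) ≤ x / 200 :=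
    calc _ ≤ M * (x / (200 * M)) := by gcongr; exact Real.log_le_self (by positivity)
      _ = x / 200 := by field_simp
  have h800 : M * Real.log 800 ≤ M * 7 := by gcongr; exact log_800_le
  rw [hsplit]
  rcases le_or_gt (Real.exp 1) t with ht | ht
  · linarith [hlarge ht]
  · linarith [hsmall (by linarith [Real.exp_one_lt_d9])]

lemma complexity_eq (L σ R β ε : ℝ) :
    complexity L σ R β ε = max √(L * R ^ 2 / ε) ((σ * R / ε) ^ 2)
      * Real.log ((L * R ^ 2 / ε + σ * R / ε) / β) := by
  rw [complexity, div_pow, mul_pow, ← add_div, div_div]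

lemma two_le_logFactor (hβ : 0 < β) (hβ1 : β ≤ 1) (hN : 2 ≤ N) : 2 ≤ logFactor N β := by
  have hN' : (2 : ℝ) ≤ N := by exact_mod_cast hN
  rw [logFactor, Real.le_log_iff_exp_le (by positivity)]
  calc Real.exp 2 = Real.exp 1 ^ 2 := (Real.exp_one_pow 2).symm
    _ ≤ 2.8 ^ 2 := by gcongr; linarith [Real.exp_one_lt_d9]
    _ ≤ 4 * N := by linarith
    _ ≤ 4 * N / β := le_div_self (by positivity) hβ hβ1

lemma exp_neg_logFactor_le (hβ : 0 < β) (hN : 1 ≤ N) : Real.exp (-logFactor N β) ≤ β := by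
  have hN' : (1 : ℝ) ≤ N := by exact_mod_cast hN
  rw [Real.exp_neg, logFactor, Real.exp_log (by positivity), inv_div]
  exact div_le_self hβ.le (by linarith)

lemma one_sub_le_measureReal_output_sub_le {n : ℕ} {Ξ : Type u} [MeasurableSpace Ξ]
    {D : Measure Ξ} [IsFiniteMeasure D] {Ω : Type v} [MeasurableSpace Ω] {μ : Measure Ω}
    [IsProbabilityMeasure μ] {f : E n → ℝ} {G : E n → Ξ → E n} {ξ : ℕ → ℕ → Ω → Ξ} {x0 xs : E n}
    (hL : 0 < L) (hσ : 0 ≤ σ) (hβ : 0 < β) (hβ1 : β ≤ 1) (hc : ConvexOn ℝ Set.univ f)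
    (hf : IsSmooth L f) (hxs : ∀ x, f xs ≤ f x) (hx : x0 ≠ xs)
    (hG : IsStochasticGradient D f G σ) (hξ : ∀ k i, MeasurePreserving (ξ k i) μ D)
    (hind : iIndepFun (fun p : ℕ × ℕ => ξ p.1 p.2) μ) (hε : 0 < ε)
    (hN : 20000 * max 1 (complexity L σ ‖x0 - xs‖ β ε) ≤ N) :
    1 - β ≤ μ.real {ω | f (output G (stepParam L σ ‖x0 - xs‖ β N) L (clipParam ‖x0 - xs‖ β N)
      (batchSize L σ ‖x0 - xs‖ β N) x0 (fun k i => ξ k i ω) N) - f xs ≤ ε} := by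
  have hR : 0 < ‖x0 - xs‖ := norm_sub_pos_iff.2 hx
  have hN2 : 2 ≤ N := by
    have : (2 : ℝ) ≤ N := by linarith [le_max_left 1 (complexity L σ ‖x0 - xs‖ β ε)]
    exact_mod_cast this
  have hl := two_le_logFactor hβ hβ1 hN2
  have hρ : 5 * ‖x0 - xs‖ ^ 2 = (constC * ‖x0 - xs‖) ^ 2 := by rw [mul_pow, constC_sq]
  have hC : 0 < constC := Real.sqrt_pos.2 (by norm_num)
  have hNa := mul_stepParam_mul_le hL hR hε hl <| mul_log_le_of_le (by positivity) (by positivity)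
    hβ hβ1 (complexity_eq L σ ‖x0 - xs‖ β ε ▸ hN)
  calc 1 - β ≤ 1 - Real.exp (-logFactor N β) :=
        sub_le_sub_left (exp_neg_logFactor_le hβ (by omega)) 1
    _ ≤ _ := one_sub_exp_le_measureReal_bigA_mul_le hf hc hxs hL hl (by positivity) hρ.le
        (mul_stepRoot_sq_le_stepParam L σ _ β N) hG hξ hind (by omega)
        (batchSize_pos L σ _ β N) (alpha_sq_mul_variance_le hR (by omega) (by linarith))
    _ ≤ _ := measureReal_mono fun ω hω => le_of_bigA_mul_le (stepParam_pos L σ _ β N) hL hε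
        (by omega) hNa (hω.trans_eq (by rw [← hρ]; ring))

end Complexity

end ClippedSSTM

open ClippedSSTM

theorem mainTheorem3 :
    -- a single numerical constant `K` for all problems, dimensions and parameters
    ∃ K : ℝ, 0 < K ∧
      ∀ (n : ℕ) (Ξ : Type u) [MeasurableSpace Ξ] (D : Measure Ξ) [IsProbabilityMeasure D]
        (Ω : Type v) [MeasurableSpace Ω] (μ : Measure Ω) [IsProbabilityMeasure μ]
        (f : ClippedSSTM.E n → ℝ) (G : ClippedSSTM.E n → Ξ → ClippedSSTM.E n)
        (ξ : ℕ → ℕ → Ω → Ξ) (L σ β : ℝ) (x0 xs : ClippedSSTM.E n),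
        0 < L → 0 ≤ σ → 0 < β → β < 1 →
        ConvexOn ℝ Set.univ f →
        ClippedSSTM.IsSmooth L f →
        (∀ x, f xs ≤ f x) →
        x0 ≠ xs →
        ClippedSSTM.IsStochasticGradient D f G σ →
        -- the samples `ξ k i` are independent with common distribution `D`
        (∀ k i, Measurable (ξ k i)) →
        (∀ k i, μ.map (ξ k i) = D) →
        iIndepFun (fun p : ℕ × ℕ => ξ p.1 p.2) μ →
        -- the batch sizes are bounded by a numerical constant
        (∀ N : ℕ, 1 ≤ N → 2 ≤ Real.log (4 * N / β) →
          ∀ k ≤ N, (ClippedSSTM.batchSize L σ ‖x0 - xs‖ β N k : ℝ) ≤ K) ∧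
        -- iteration and oracle complexity of reaching accuracy `ε` with probability `≥ 1 - β`
        (∀ ε : ℝ, 0 < ε →
          ∃ N₀ : ℕ, 1 ≤ N₀ ∧ 2 ≤ Real.log (4 * N₀ / β) ∧
            (N₀ : ℝ) ≤ K * max 1 (ClippedSSTM.complexity L σ ‖x0 - xs‖ β ε) ∧
            ((∑ k ∈ Finset.range N₀, ClippedSSTM.batchSize L σ ‖x0 - xs‖ β N₀ k : ℕ) : ℝ)
              ≤ K * max 1 (ClippedSSTM.complexity L σ ‖x0 - xs‖ β ε) ∧
            ∀ N : ℕ, N₀ ≤ N →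
              1 - β ≤ μ.real {ω |
                f (ClippedSSTM.output G (ClippedSSTM.stepParam L σ ‖x0 - xs‖ β N) L
                    (ClippedSSTM.clipParam ‖x0 - xs‖ β N)
                    (ClippedSSTM.batchSize L σ ‖x0 - xs‖ β N) x0
                    (fun k i => ξ k i ω) N) - f xs ≤ ε}) := by
  refine ⟨2701 * 20001, by norm_num, ?_⟩
  intro n Ξ _ D _ Ω _ μ _ f G ξ L σ β x0 xs hL hσ hβ hβ1 hc hf hxs hx hG hξ hD hind
  have hR : 0 < ‖x0 - xs‖ := norm_sub_pos_iff.2 hx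
  refine ⟨fun N hN hl k hk => (batchSize_le hL hσ hR hN hl hk).trans (by norm_num), fun ε hε => ?_⟩
  set V := max 1 (complexity L σ ‖x0 - xs‖ β ε)
  have hV : 1 ≤ V := le_max_left _ _
  set N₀ := ⌈20000 * V⌉₊
  have hle : 20000 * V ≤ N₀ := Nat.le_ceil _
  have hge : (N₀ : ℝ) ≤ 20001 * V := by
    linarith [Nat.ceil_lt_add_one (by positivity : 0 ≤ 20000 * V)]
  have hN₀ : 2 ≤ N₀ := by
    have : (2 : ℝ) ≤ N₀ := by linarith
    exact_mod_cast this
  have hl := two_le_logFactor hβ hβ1.le hN₀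
  exact ⟨N₀, by omega, hl, by linarith,
    (sum_batchSize_le hL hσ hR (by omega) hl).trans (by linarith), fun N hN =>
      one_sub_le_measureReal_output_sub_le hL hσ hβ hβ1.le hc hf hxs hx hG
        (fun k i => ⟨hξ k i, hD k i⟩) hind hε (hle.trans (Nat.cast_le.2 hN))⟩
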